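/- **Setting.** Let $\mathfrak R^n$ be the class of compact sets $\Omega\subset\mathbb R^n$ whose interior $\Omega^\circ$ is a connected neighbourhood of the origin and which satisfy $\Omega=\overline{\Omega^\circ}$. Consider $\dot x=f(x)+G(x)u$ with $x\in\mathcal X\in\mathfrak R^n$, $u\in\mathcal U=\{u\in\mathbb R^m: Hu\le h_c\}\in\mathfrak R^m$ and $f(0)=0$. Let $\mathcal T=\{\sigma_i\}$ be a triangulation: a finite collection of $n$-simplexes $\sigma_i=\mathrm{co}\{x_{i,0},\dots,x_{i,n}\}$, any two meeting in a common face or not at all, whose union (also written $\mathcal T$) lies in $\mathfrak R^n$ and in $\mathcal X$, and with $x_{i,0}=0$ whenever $0\in\sigma_i$. Let $\mathbb E$ be its set of vertices. Assume that $f$ and $G$ are continuous on $\mathcal T$ and $C^2$ on each $\sigma_i$ (derivatives on $\sigma_i$ are taken within $\sigma_i$). For vertex values $W$ on $\mathbb E$, the CPA (continuous piecewise affine) interpolation is the function on $\mathcal T$ that is affine on each $\sigma_i$ with these vertex values, and $\nabla W_i$ is its gradient on $\sigma_i$. The unknowns are $y=[\mathbf V,\mathbf L,\mathbf U,\mathbf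 Z,a,b_1,b_2]$ with $V_x\in\mathbb R$ and $u_x\in\mathbb R^m$ for $x\in\mathbb E$, $l_i\in\mathbb R^n$ and $z_i\in\mathbb R$ for each simplex, and $a,b_1,b_2\in\mathbb R$. The constraints are (absolute values and inequalities between vectors are componentwise, and a bound by the scalar $z_i$ means a bound of every component) $$V_0=0,\quad a,b_1>0,\quad b_1\|x\|^a\le V_x\ (x\in\mathbb E\setminus\{0\}),\quad |\nabla V_i|\le l_i,$$ $$u_0=0,\quad Hu_x\le h_c\ (x\in\mathbb E\setminus\{0\}),\quad |\nabla u^{(s)}_i|\le z_i,\quad D^+_{i,j}V\le -b_2V_{x_{i,j}},$$ for all $i,j,s$, where $D^+_{i,j}V=\phi_{i,j}+u_{x_{i,j}}^\top G(x_{i,j})^\top\nabla V_i+c_{i,j}\eta_iz_i1_n^\top l_i$, $\phi_{i,j}=f(x_{i,j})^\top\nabla V_i+c_{i,j}\mu_i1_n^\top l_i$, $c_{i,j}=\frac n2\|x_{i,j}-x_{i,0}\|\big(\max_{1\le k\le n}\|x_{i,k}-x_{i,0}\|+\|x_{i,j}-x_{i,0}\|\big)$, $$\mu_i=\max_{p,q,r}\max_{\xi\in\sigma_i}\Big(\big|\tfrac{\partial^2f^{(p)}}{\partial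 x^{(q)}\partial x^{(r)}}(\xi)\big|+\sum_{s=1}^m\big|\tfrac{\partial^2G^{(p,s)}}{\partial x^{(q)}\partial x^{(r)}}(\xi)\big|\max_{u\in\mathcal U}|u^{(s)}|\Big),$$ $$\eta_i=\max_{p,q,r}\max_{\xi\in\sigma_i}\sum_{s=1}^m\Big(\big|\tfrac{\partial G^{(p,s)}}{\partial x^{(q)}}(\xi)\big|+\big|\tfrac{\partial G^{(p,s)}}{\partial x^{(r)}}(\xi)\big|\Big)$$ (for $n=0$ put $\mu_i=\eta_i=0$). **Theorem.** The maxima exist, and the constraints are feasible. Each $\nabla W_i$ is linear in the vertex values $W$; $\phi_{i,j}$ is linear in $(\mathbf V,\mathbf L)$ and $D^+_{i,j}V-\phi_{i,j}$ is bilinear in $(\mathbf U,\mathbf Z)$ and $(\mathbf V,\mathbf L)$. So the only nonlinear terms of the constraints are these, $b_2V_{x_{i,j}}$ and $b_1\|x\|^a$ (which is linear in $b_1$ for fixed $a$). Let $y$ be any feasible point (in particular, a minimizer of any cost over the feasible set), $V$ and $u$ the CPA functions with vertex values $V_x$ and $u_x$, and $g(x)=f(x)+G(x)u(x)$ on $\mathcal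 T$. Then: 1. $u(x)\in\mathcal U$ for all $x\in\mathcal T$. On $\sigma_i$, $\mu_i+\eta_iz_i$ bounds the absolute values of all second partial derivatives of the components of $g$, and $D^+_{i,j}V=g(x_{i,j})^\top\nabla V_i+c_{i,j}(\mu_i+\eta_iz_i)1_n^\top l_i$. 2. If $b_2>0$, then $V$ is a Lyapunov function of $\dot x=g(x)$ on $\mathcal T$: it is Lipschitz, $V(0)=0$, for some $b>0$ one has $b\|x\|\le V(x)$ on $\mathcal T$, and the Dini derivative satisfies $D^+V(x)=\limsup_{h\to0^+}\frac{V(x+hg(x))-V(x)}h\le-b_2V(x)$ for $x\in\mathcal T^\circ\setminus\{0\}$. If $a\ge1$, also $b_1\|x\|^a\le V(x)$ on $\mathcal T$. The origin is a locally exponentially stable equilibrium of $\dot x=g(x)$ (including existence, for all later times, of solutions starting near $0$). 3. Let $b_2>0$, $r>0$, and let $\mathcal A=V^{-1}([0,r])\subseteq\mathcal T$ be in $\mathfrak R^n$. If $a\ge1$, every solution in $\mathcal T$ with $x(t_0)\in\mathcal A^\circ$ satisfies, for as long as it exists in $\mathcal T$, $$\|x(t)\|\le (r/b_1)^{1/a}\,e^{-(b_2/a)(t-t_0)}.$$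 If $V\ge r$ on $\partial\mathcal T$, then (for every $a>0$) from every $x(t_0)\in\mathcal A^\circ$ there is a solution for all $t\ge t_0$ that stays in $\mathcal A^\circ$, and every solution in $\mathcal T$ stays in $\mathcal A^\circ$ for as long as it exists. -/

import Mathlib

open Set Filter Topology Matrix

noncomputable section

namespace CPA

/-- The state space `ℝⁿ` with the Euclidean norm. -/
abbrev State (n : ℕ) : Type := EuclideanSpace ℝ (Fin n)

/-- The class `𝔑` of compact sets which are the closure of their interior and whose interior is
a connected neighbourhood of the origin. -/
def regularSets (E : Type) [TopologicalSpace E] [Zero E] : Set (Set E) :=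
  {Ω | IsCompact Ω ∧ IsConnected (interior Ω) ∧ (0 : E) ∈ interior Ω ∧ Ω = closure (interior Ω)}

/-- A triangulation in `ℝⁿ`: finitely many `n`-simplexes `σ_i = co {x_{i,0}, …, x_{i,n}}` any two
of which meet in a common face or not at all, whose union belongs to `𝔑`, and such that `0` is the
vertex `x_{i,0}` of every simplex `σ_i` that contains it. -/
structure Triangulation (n : ℕ) where
  /-- the number of simplexes -/
  card : ℕ
  /-- the vertices `x_{i,j}` -/
  vert : Fin card → Fin (n + 1) → State n
  affineIndependent : ∀ i, AffineIndependent ℝ (vert i)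
  inter_face : ∀ i k,
    convexHull ℝ (range (vert i)) ∩ convexHull ℝ (range (vert k)) =
      convexHull ℝ (range (vert i) ∩ range (vert k))
  union_mem : (⋃ i, convexHull ℝ (range (vert i))) ∈ regularSets (State n)
  vert_zero : ∀ i, (0 : State n) ∈ convexHull ℝ (range (vert i)) → vert i 0 = 0

namespace Triangulation

variable {n : ℕ} (T : Triangulation n)

/-- The simplex `σ_i`. -/
def simplex (i : Fin T.card) : Set (State n) := convexHull ℝ (range (T.vert i))

/-- The set of points covered by the triangulation. -/
def carrier : Set (State n) := ⋃ i, T.simplex i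

/-- The set of all vertices of the triangulation. -/
def vertices : Set (State n) := {x | ∃ i j, T.vert i j = x}

/-- `x_{i,j}` as an element of the vertex set. -/
def vtx (i : Fin T.card) (j : Fin (n + 1)) : T.vertices := ⟨T.vert i j, i, j, rfl⟩

theorem zero_mem_vertices : (0 : State n) ∈ T.vertices := by
  have h : (0 : State n) ∈ ⋃ i, convexHull ℝ (range (T.vert i)) :=
    interior_subset T.union_mem.2.2.1
  obtain ⟨i, hi⟩ := mem_iUnion.1 h
  exact ⟨i, 0, T.vert_zero i hi⟩

/-- The origin as an element of the vertex set. -/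
def origin : T.vertices := ⟨0, T.zero_mem_vertices⟩

/-- The matrix `X_i` whose `j`-th row is `x_{i,j} - x_{i,0}`. -/
def edgeMatrix (i : Fin T.card) : Matrix (Fin n) (Fin n) ℝ :=
  Matrix.of fun j k => T.vert i j.succ k - T.vert i 0 k

/-- The gradient on `σ_i` of the CPA interpolation of the vertex values `W`: it is `X_i⁻¹ W̄_i`,
where `W̄_i` has the entries `W_{x_{i,j}} - W_{x_{i,0}}`. -/
def grad (i : Fin T.card) (W : T.vertices → ℝ) : Fin n → ℝ :=
  (T.edgeMatrix i)⁻¹ *ᵥ fun j => W (T.vtx i j.succ) - W (T.vtx i 0)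

/-- The affine function that takes the values `W` at the vertices of `σ_i`. -/
def piece (i : Fin T.card) (W : T.vertices → ℝ) (x : State n) : ℝ :=
  W (T.vtx i 0) + T.grad i W ⬝ᵥ fun k => x k - T.vert i 0 k

open Classical in
/-- The CPA interpolation of the vertex values `W` (set to `0` outside the triangulation). -/
def interp (W : T.vertices → ℝ) (x : State n) : ℝ :=
  if h : ∃ i, x ∈ T.simplex i then T.piece h.choose W x else 0

theorem isUnit_edgeMatrix (i : Fin T.card) : IsUnit (T.edgeMatrix i) := by
  rw [← Matrix.linearIndependent_rows_iff_isUnit]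
  have h := (affineIndependent_iff_linearIndependent_vsub ℝ (T.vert i) 0).1 (T.affineIndependent i)
  have h2 := h.comp (fun j : Fin n => (⟨j.succ, Fin.succ_ne_zero j⟩ : {x : Fin (n + 1) // x ≠ 0}))
    (fun a b hab => by simpa using hab)
  exact h2.map' (WithLp.linearEquiv 2 ℝ (Fin n → ℝ)).toLinearMap (LinearEquiv.ker _)

theorem piece_vtx (i : Fin T.card) (W : T.vertices → ℝ) (j : Fin (n + 1)) :
    T.piece i W (T.vert i j) = W (T.vtx i j) := by
  refine Fin.cases ?_ (fun j => ?_) j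
  · simp [piece, dotProduct]
  · have h : T.edgeMatrix i *ᵥ T.grad i W = fun j => W (T.vtx i j.succ) - W (T.vtx i 0) := by
      rw [grad, Matrix.mulVec_mulVec, Matrix.mul_nonsing_inv _
        ((Matrix.isUnit_iff_isUnit_det _).1 (T.isUnit_edgeMatrix i)), Matrix.one_mulVec]
    have h2 := congrFun h j
    have h3 : (T.grad i W ⬝ᵥ fun k => T.vert i j.succ k - T.vert i 0 k)
        = (T.edgeMatrix i *ᵥ T.grad i W) j := by
      rw [dotProduct_comm]; rfl
    rw [piece, h3, h2]; ring

theorem piece_convex (i : Fin T.card) (W : T.vertices → ℝ) (x y : State n) (a b : ℝ)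
    (hab : a + b = 1) :
    T.piece i W (a • x + b • y) = a * T.piece i W x + b * T.piece i W y := by
  obtain rfl : b = 1 - a := by linarith
  simp only [piece, dotProduct, PiLp.add_apply, PiLp.smul_apply, smul_eq_mul]
  have : ∀ k, T.grad i W k * (a * x k + (1 - a) * y k - T.vert i 0 k)
      = a * (T.grad i W k * (x k - T.vert i 0 k))
        + (1 - a) * (T.grad i W k * (y k - T.vert i 0 k)) := fun k => by ring
  simp only [this, Finset.sum_add_distrib, ← Finset.mul_sum]
  ring

theorem piece_eq_piece (i k : Fin T.card) (W : T.vertices → ℝ) (x : State n)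
    (hi : x ∈ T.simplex i) (hk : x ∈ T.simplex k) : T.piece i W x = T.piece k W x := by
  have hx : x ∈ convexHull ℝ (range (T.vert i) ∩ range (T.vert k)) := by
    rw [← T.inter_face]; exact ⟨hi, hk⟩
  have hc : Convex ℝ {x | T.piece i W x = T.piece k W x} := by
    intro x hx y hy a b _ _ hab
    simp only [mem_ofPred_eq] at hx hy ⊢
    rw [T.piece_convex i W x y a b hab, T.piece_convex k W x y a b hab, hx, hy]
  refine convexHull_min ?_ hc hx
  rintro y ⟨⟨j, rfl⟩, ⟨l, hl⟩⟩
  have h : T.vtx k l = T.vtx i j := Subtype.ext hl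
  simp only [mem_ofPred_eq]
  rw [T.piece_vtx i W j, ← h, ← T.piece_vtx k W l, hl]

/-- The interpolation is well defined: on each simplex it is the affine function that takes the
prescribed values at the vertices of that simplex. -/
theorem interp_eq_piece (i : Fin T.card) (W : T.vertices → ℝ) (x : State n)
    (hx : x ∈ T.simplex i) : T.interp W x = T.piece i W x := by
  have h : ∃ i, x ∈ T.simplex i := ⟨i, hx⟩
  rw [interp, dif_pos h]
  exact T.piece_eq_piece _ _ W x h.choose_spec hx

/-- The number `c_{i,j}`. -/
def c (i : Fin T.card) (j : Fin (n + 1)) : ℝ :=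
  (n : ℝ) / 2 * ‖T.vert i j - T.vert i 0‖ *
    ((⨆ k : Fin n, ‖T.vert i k.succ - T.vert i 0‖) + ‖T.vert i j - T.vert i 0‖)

/-- Continuous and piecewise `C²` on the triangulation. Membership in `C²` on a closed simplex
refers to derivatives within the simplex. -/
def PiecewiseC2 (φ : State n → ℝ) : Prop :=
  ContinuousOn φ T.carrier ∧ ∀ i, ContDiffOn ℝ 2 φ (T.simplex i)

end Triangulation

/-- The partial derivative `∂φ/∂x_q` at `ξ`, taken within the set `σ`. -/
def partialD {n : ℕ} (σ : Set (State n)) (φ : State n → ℝ) (q : Fin n) (ξ : State n) : ℝ :=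
  fderivWithin ℝ φ σ ξ (EuclideanSpace.single q 1)

/-- The second partial derivative `∂²φ/∂x_q∂x_r` at `ξ`, taken within the set `σ`. -/
def partialD2 {n : ℕ} (σ : Set (State n)) (φ : State n → ℝ) (q r : Fin n) (ξ : State n) : ℝ :=
  partialD σ (partialD σ φ r) q ξ

/-- The data of a control-affine system `ẋ = f x + G x u` with input constraints `H u ≤ h_c`. -/
structure ControlSystem (n m p : ℕ) where
  /-- the drift -/
  f : State n → State n
  /-- the input matrix -/
  G : State n → Matrix (Fin n) (Fin m) ℝ
  /-- the normals of the input polytope -/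
  H : Matrix (Fin p) (Fin m) ℝ
  /-- the offsets of the input polytope -/
  hc : Fin p → ℝ

/-- The unknowns `y = [V, L, U, Z, a, b]` of the optimization. -/
structure Unknowns {n : ℕ} (T : Triangulation n) (m : ℕ) where
  V : T.vertices → ℝ
  l : Fin T.card → Fin n → ℝ
  u : T.vertices → Fin m → ℝ
  z : Fin T.card → ℝ
  a : ℝ
  b₁ : ℝ
  b₂ : ℝ

/-- The CPA function `V` on the triangulation. -/
def Unknowns.lyap {n m : ℕ} {T : Triangulation n} (y : Unknowns T m) : State n → ℝ :=
  T.interp y.V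

/-- The CPA controller `u`: each component is the CPA interpolation of its vertex values. -/
def Unknowns.ctrl {n m : ℕ} {T : Triangulation n} (y : Unknowns T m) (x : State n) : Fin m → ℝ :=
  fun s => T.interp (fun v => y.u v s) x

/-- The sublevel set `V⁻¹([0, r])` of the CPA function `V` on the triangulation. -/
def Unknowns.sublevel {n m : ℕ} {T : Triangulation n} (y : Unknowns T m) (r : ℝ) :
    Set (State n) :=
  {x | x ∈ T.carrier ∧ y.lyap x ∈ Icc 0 r}

namespace ControlSystem

variable {n m p : ℕ} (S : ControlSystem n m p) (T : Triangulation n)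

/-- The polytope of admissible inputs. -/
def inputs : Set (Fin m → ℝ) := {u | S.H *ᵥ u ≤ S.hc}

/-- The largest absolute value of the `s`-th coordinate over the admissible inputs. -/
def inputBound (s : Fin m) : ℝ := sSup ((fun u : Fin m → ℝ => |u s|) '' S.inputs)

/-- The numbers whose maximum is `μ_i`. -/
def muSet (i : Fin T.card) : Set ℝ :=
  {t | ∃ p' q r : Fin n, ∃ ξ ∈ T.simplex i,
    t = |partialD2 (T.simplex i) (fun x => S.f x p') q r ξ| +
      ∑ s, |partialD2 (T.simplex i) (fun x => S.G x p' s) q r ξ| * S.inputBound s}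

/-- The numbers whose maximum is `η_i`. -/
def etaSet (i : Fin T.card) : Set ℝ :=
  {t | ∃ p' q r : Fin n, ∃ ξ ∈ T.simplex i,
    t = ∑ s, (|partialD (T.simplex i) (fun x => S.G x p' s) q ξ| +
      |partialD (T.simplex i) (fun x => S.G x p' s) r ξ|)}

/-- The constant `μ_i`. -/
def mu (i : Fin T.card) : ℝ := sSup (S.muSet T i)

/-- The constant `η_i`. -/
def eta (i : Fin T.card) : ℝ := sSup (S.etaSet T i)

variable {T}

/-- `φ_{i,j}`. -/
def phi (y : Unknowns T m) (i : Fin T.card) (j : Fin (n + 1)) : ℝ :=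
  (S.f (T.vert i j)).ofLp ⬝ᵥ T.grad i y.V + T.c i j * S.mu T i * ∑ k, y.l i k

/-- `D⁺_{i,j} V`. -/
def dplus (y : Unknowns T m) (i : Fin T.card) (j : Fin (n + 1)) : ℝ :=
  S.phi y i j + (S.G (T.vert i j) *ᵥ y.u (T.vtx i j)) ⬝ᵥ T.grad i y.V +
    T.c i j * S.eta T i * y.z i * ∑ k, y.l i k

/-- The constraints of the optimization. -/
structure Feasible (y : Unknowns T m) : Prop where
  V_zero : y.V T.origin = 0
  a_pos : 0 < y.a
  b₁_pos : 0 < y.b₁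
  V_lower : ∀ v : T.vertices, (v : State n) ≠ 0 → y.b₁ * ‖(v : State n)‖ ^ y.a ≤ y.V v
  grad_V : ∀ i k, |T.grad i y.V k| ≤ y.l i k
  u_zero : y.u T.origin = 0
  u_mem : ∀ v : T.vertices, (v : State n) ≠ 0 → S.H *ᵥ y.u v ≤ S.hc
  grad_u : ∀ i s k, |T.grad i (fun v => y.u v s) k| ≤ y.z i
  decrease : ∀ i j, S.dplus y i j ≤ -y.b₂ * y.V (T.vtx i j)

/-- The closed-loop vector field `g x = f x + G x (u x)`. -/
def closedLoop (y : Unknowns T m) (x : State n) : State n :=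
  S.f x + WithLp.toLp 2 (S.G x *ᵥ y.ctrl x)

end ControlSystem

/-- The Dini derivative of `V` along the vector field `g` at `x`, as an extended real number. -/
def dini {n : ℕ} (g : State n → State n) (V : State n → ℝ) (x : State n) : EReal :=
  limsup (fun h : ℝ => (((V (x + h • g x) - V x) / h : ℝ) : EReal)) (𝓝[>] 0)

/-- `V` is a Lyapunov function on `Ω` for `ẋ = g x` with the constants `a`, `b₁`, `b₂`. -/
structure IsLyapunov {n : ℕ} (g : State n → State n) (Ω : Set (State n)) (V : State n → ℝ)
    (a b₁ b₂ : ℝ) : Prop where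
  a_pos : 0 < a
  b₁_pos : 0 < b₁
  b₂_pos : 0 < b₂
  lipschitz : ∃ K, LipschitzOnWith K V Ω
  zero : V 0 = 0
  lower : ∀ x ∈ Ω, b₁ * ‖x‖ ^ a ≤ V x
  decrease : ∀ x ∈ interior Ω, x ≠ 0 → dini g V x ≤ ((-b₂ * V x : ℝ) : EReal)

/-- `x` solves `ẋ = g x` on the time interval `I` and stays in `Ω`. -/
def IsSolution {n : ℕ} (g : State n → State n) (Ω : Set (State n)) (I : Set ℝ)
    (x : ℝ → State n) : Prop :=
  ∀ t ∈ I, x t ∈ Ω ∧ HasDerivWithinAt x (g (x t)) I t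

/-- The origin is a locally exponentially stable equilibrium of `ẋ = g x`, `x ∈ Ω`: from every
initial state near `0` there is a solution for all later times, and all solutions
satisfy an exponential estimate for as long as they exist in `Ω`. -/
def IsLocallyExpStable {n : ℕ} (g : State n → State n) (Ω : Set (State n)) : Prop :=
  g 0 = 0 ∧ ∃ δ > 0, ∃ k > 0, ∃ rate > 0, ∀ t₀ : ℝ, ∀ x₀ : State n, ‖x₀‖ < δ →
    (∃ x : ℝ → State n, x t₀ = x₀ ∧ IsSolution g Ω (Ici t₀) x) ∧
    ∀ t₁ : ℝ, ∀ x : ℝ → State n, x t₀ = x₀ → IsSolution g Ω (Icc t₀ t₁) x →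
      ∀ t ∈ Icc t₀ t₁, ‖x t‖ ≤ k * ‖x₀‖ * Real.exp (-rate * (t - t₀))

end CPA

end

/-! On one simplex the closed loop g is C² and V is affine. Comparing g with its affine
interpolation on σ_i costs at most the weighted sum of the c_{i,j} times a bound β on second
derivatives. Since u is affine on σ_i, only second derivatives of f and G and products of first
derivatives of G with ∇u occur, so β = μ_i + η_i z_i works. The error terms in D⁺_{i,j} V are
exactly this budget, and V interpolates its vertex values exactly. Averaging the vertex constraints
with barycentric weights therefore gives ∇V_i · g ≤ -b₂ V on all of σ_i (`gradCLM_closedLoop_le`).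

A short step along a trajectory stays in a simplex that also contains the starting point, so this
gradient inequality bounds the right slopes of V, and Gronwall gives exponential decay
(`lyap_le_mul_exp`). Lower bounds on V by convex functions of x need only be checked at vertices;
together with decay they give all the norm estimates.

Existence of solutions needs g Lipschitz on the whole, possibly nonconvex, triangulation. For two
simplexes with a common face, a separating hyperplane touching each exactly in that face allows a
detour through the face of length comparable to the distance (`exists_mem_inter_norm_sub_le`). Hence
Lipschitz bounds on the simplexes glue (`exists_lipschitzOnWith_carrier`). Then g extends to a
bounded Lipschitz field with global forward solutions, and the decay of V traps these in a ball or
in a sublevel set. -/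

/-! ### Two simplexes with a common face: separation and linear regularity. -/

namespace AffineBasis

variable {E ι κ : Type*} [NormedAddCommGroup E] [NormedSpace ℝ E]

theorem coord_vadd_smul (p : AffineBasis ι ℝ E) (i : ι) (x d : E) (t : ℝ) :
    p.coord i (x + t • d) = p.coord i x + t * (p.coord i).linear d := by
  have h := (p.coord i).map_vadd x (t • d)
  simp only [vadd_eq_add, map_smul, smul_eq_mul] at h
  rw [add_comm x, h, add_comm]

theorem coord_linear_sub (p : AffineBasis ι ℝ E) (i : ι) (x y : E) :
    (p.coord i).linear (x - y) = p.coord i x - p.coord i y := by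
  have h := (p.coord i).linearMap_vsub x y
  simpa using h

theorem coord_eq_zero_of_mem_convexHull (p : AffineBasis ι ℝ E) {i : ι} {s : Set E}
    (hs : s ⊆ range p) (hi : p i ∉ s) {x : E} (hx : x ∈ convexHull ℝ s) : p.coord i x = 0 := by
  have hc : Convex ℝ {x | p.coord i x = 0} := by
    have := (convex_singleton (𝕜 := ℝ) (0 : ℝ)).affine_preimage (p.coord i)
    exact this
  refine convexHull_min ?_ hc hx
  intro y hy
  obtain ⟨j, rfl⟩ := hs hy
  refine p.coord_apply_ne ?_
  rintro rfl
  exact hi hy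

/-- A direction which points into both of two simplexes at the relative interior of their common
face is parallel to this face. -/
theorem coord_linear_eq_zero_of_nonneg [Finite ι] [Finite κ]
    (p : AffineBasis ι ℝ E) (q : AffineBasis κ ℝ E)
    (h : convexHull ℝ (range p) ∩ convexHull ℝ (range q) = convexHull ℝ (range p ∩ range q))
    (hne : (range p ∩ range q).Nonempty) {d : E}
    (hp : ∀ i, p i ∉ range q → 0 ≤ (p.coord i).linear d)
    (hq : ∀ k, q k ∉ range p → 0 ≤ (q.coord k).linear d) :
    (∀ i, p i ∉ range q → (p.coord i).linear d = 0) ∧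
      ∀ k, q k ∉ range p → (q.coord k).linear d = 0 := by
  classical
  have hfin : (range p ∩ range q).Finite := (finite_range p).inter_of_left _
  set F : Finset E := hfin.toFinset with hF
  have hFmem : ∀ x, x ∈ F ↔ x ∈ range p ∧ x ∈ range q := fun x => by simp [hF]
  have hFne : F.Nonempty := by simpa [hF] using hne
  set N : ℝ := (F.card : ℝ)⁻¹ with hN
  have hNpos : 0 < N := by
    have : 0 < F.card := hFne.card_pos
    positivity
  -- The barycentre of the common face has positive coordinates at all shared vertices and zero
  -- coordinates at the others. So c + t d lies in both simplexes for small t > 0, hence in the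
  -- common face, where the coordinates off the face vanish.
  set c : E := ∑ v ∈ F, N • v with hc
  have hcs : c ∈ convexHull ℝ (range p ∩ range q) := by
    refine (convex_convexHull ℝ _).sum_mem (fun _ _ => hNpos.le) ?_ fun v hv =>
      subset_convexHull ℝ _ ((hFmem v).1 hv)
    rw [Finset.sum_const, nsmul_eq_mul, hN]
    have : (F.card : ℝ) ≠ 0 := by exact_mod_cast hFne.card_pos.ne'
    field_simp
  have key : ∀ (g : E →ᵃ[ℝ] ℝ) (w : E), w ∈ F → 0 < g w → (∀ v ∈ F, 0 ≤ g v) → 0 < g c := by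
    intro g w hw hgw hg
    have h1 : g c = ∑ v ∈ F, N * g v := by
      have h2 : ∑ v ∈ F, N = 1 := by
        rw [Finset.sum_const, nsmul_eq_mul, hN]
        have : (F.card : ℝ) ≠ 0 := by exact_mod_cast hFne.card_pos.ne'
        field_simp
      have h3 := Finset.map_affineCombination F (fun v : E => v) (fun _ => N) h2 g
      rw [Finset.affineCombination_eq_linear_combination _ _ _ h2,
        Finset.affineCombination_eq_linear_combination _ _ _ h2] at h3
      simpa using h3
    rw [h1]
    exact Finset.sum_pos' (fun v hv => mul_nonneg hNpos.le (hg v hv)) ⟨w, hw, mul_pos hNpos hgw⟩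
  -- A positive coordinate survives a small step in any direction; a zero coordinate survives if the
  -- direction does not decrease it.
  have evt : ∀ (α : ℝ) (β : ℝ), 0 ≤ α → (α = 0 → 0 ≤ β) → ∀ᶠ t in 𝓝[>] (0 : ℝ), 0 ≤ α + t * β := by
    intro α β hα hβ
    rcases hα.eq_or_lt with rfl | hα
    · filter_upwards [self_mem_nhdsWithin] with t ht
      rw [zero_add]
      exact mul_nonneg (le_of_lt ht) (hβ rfl)
    · have hcont : Tendsto (fun t : ℝ => α + t * β) (𝓝[>] 0) (𝓝 α) := by
        have : Continuous fun t : ℝ => α + t * β := by fun_prop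
        have h0 := this.tendsto 0
        simp only [zero_mul, add_zero] at h0
        exact h0.mono_left nhdsWithin_le_nhds
      filter_upwards [hcont.eventually (lt_mem_nhds hα)] with t ht using ht.le
  have hcp : ∀ i, p i ∉ range q → p.coord i c = 0 := fun i hi =>
    p.coord_eq_zero_of_mem_convexHull inter_subset_left (fun hh => hi hh.2) hcs
  have hcq : ∀ k, q k ∉ range p → q.coord k c = 0 := fun k hk =>
    q.coord_eq_zero_of_mem_convexHull inter_subset_right (fun hh => hk hh.1) hcs
  have hP : ∀ᶠ t in 𝓝[>] (0 : ℝ), c + t • d ∈ convexHull ℝ (range p) := by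
    simp only [p.convexHull_eq_nonneg_coord, mem_ofPred_eq, coord_vadd_smul]
    refine eventually_all.2 fun i => ?_
    by_cases hi : p i ∈ range q
    · have := key (p.coord i) (p i) ((hFmem _).2 ⟨mem_range_self i, hi⟩)
        (by rw [p.coord_apply_eq]; exact one_pos) fun v hv => by
          obtain ⟨k, rfl⟩ := ((hFmem v).1 hv).1
          rw [p.coord_apply]; split_ifs <;> simp
      exact evt _ _ this.le fun h0 => absurd h0 this.ne'
    · exact evt _ _ (hcp i hi).ge fun _ => hp i hi
  have hQ : ∀ᶠ t in 𝓝[>] (0 : ℝ), c + t • d ∈ convexHull ℝ (range q) := by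
    simp only [q.convexHull_eq_nonneg_coord, mem_ofPred_eq, coord_vadd_smul]
    refine eventually_all.2 fun i => ?_
    by_cases hi : q i ∈ range p
    · have := key (q.coord i) (q i) ((hFmem _).2 ⟨hi, mem_range_self i⟩)
        (by rw [q.coord_apply_eq]; exact one_pos) fun v hv => by
          obtain ⟨k, rfl⟩ := ((hFmem v).1 hv).2
          rw [q.coord_apply]; split_ifs <;> simp
      exact evt _ _ this.le fun h0 => absurd h0 this.ne'
    · exact evt _ _ (hcq i hi).ge fun _ => hq i hi
  obtain ⟨t, ⟨htp, htq⟩, ht⟩ := ((hP.and hQ).and self_mem_nhdsWithin).exists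
  have ht0 : t ≠ 0 := (ne_of_gt ht)
  have hm : c + t • d ∈ convexHull ℝ (range p ∩ range q) := h ▸ ⟨htp, htq⟩
  refine ⟨fun i hi => ?_, fun k hk => ?_⟩
  · have h1 := p.coord_eq_zero_of_mem_convexHull inter_subset_left (fun hh => hi hh.2) hm
    rw [coord_vadd_smul, hcp i hi, zero_add] at h1
    exact (mul_eq_zero.1 h1).resolve_left ht0
  · have h1 := q.coord_eq_zero_of_mem_convexHull inter_subset_right (fun hh => hk hh.1) hm
    rw [coord_vadd_smul, hcq k hk, zero_add] at h1
    exact (mul_eq_zero.1 h1).resolve_left ht0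

/-- Two simplexes that meet in a common face are separated by a hyperplane which touches each of
them exactly in this face. -/
theorem exists_separating [Fintype ι] [Fintype κ]
    (p : AffineBasis ι ℝ E) (q : AffineBasis κ ℝ E)
    (h : convexHull ℝ (range p) ∩ convexHull ℝ (range q) = convexHull ℝ (range p ∩ range q))
    {v : E} (hvp : v ∈ range p) (hvq : v ∈ range q) :
    ∃ (f : E →L[ℝ] ℝ) (c : ℝ), 0 < c ∧ (∀ i, p i ∈ range q → f (p i - v) = 0) ∧
      (∀ i, p i ∉ range q → c ≤ f (p i - v)) ∧ ∀ k, f (q k - v) ≤ 0 := by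
  classical
  -- A functional that vanishes on the direction space W of the face and is of one strict sign on
  -- all values of r is what is wanted. Hahn–Banach supplies it once the hull of r misses W.
  set W : Submodule ℝ E := Submodule.span ℝ (range fun i : {i // p i ∈ range q} => p i - v) with hW
  let r : ({i // p i ∉ range q} ⊕ {k // q k ∉ range p}) → E :=
    Sum.elim (fun i => p i - v) (fun k => v - q k)
  have hWfin : FiniteDimensional ℝ W := FiniteDimensional.span_of_finite ℝ (finite_range _)
  have hWcl : IsClosed (W : Set E) := W.closed_of_finiteDimensional
  have hdisj : Disjoint (convexHull ℝ (range r)) (W : Set E) := by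
    rw [Set.disjoint_left]
    intro w hwK hwW
    obtain ⟨i0, hi0⟩ := hvp
    obtain ⟨k0, hk0⟩ := hvq
    rw [convexHull_range_eq_exists_affineCombination] at hwK
    obtain ⟨s, wt, hwt, hsum, hw⟩ := hwK
    rw [Finset.affineCombination_eq_linear_combination _ _ _ hsum] at hw
    set α : ({i // p i ∉ range q} ⊕ {k // q k ∉ range p}) → ℝ := fun j => if j ∈ s then wt j else 0
      with hα
    have hα0 : ∀ j, 0 ≤ α j := fun j => by
      simp only [hα]; split_ifs with hj
      · exact hwt j hj
      · exact le_rfl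
    have hα1 : ∑ j, α j = 1 := by simp [hα, hsum]
    have hαw : ∑ j, α j • r j = w := by simp [hα, ite_smul, hw]
    rw [Fintype.sum_sum_type] at hαw hα1
    simp only [r, Sum.elim_inl, Sum.elim_inr] at hαw
    obtain ⟨γ, hγ⟩ := (Submodule.mem_span_range_iff_exists_fun ℝ).1 hwW
    -- A point w of the hull in W writes d in two ways, through the vertices of q and through those
    -- of p modulo W. Its coordinates off the face are the weights α ≥ 0 in both simplexes, so they
    -- all vanish, against their sum being 1.
    set d : E := ∑ k : {k // q k ∉ range p}, α (Sum.inr k) • (q k - v) with hd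
    have hd' : d = ∑ i : {i // p i ∉ range q}, α (Sum.inl i) • (p i - v)
        - ∑ i : {i // p i ∈ range q}, γ i • (p i - v) := by
      rw [hγ, ← hαw, hd]
      simp only [smul_sub, Finset.sum_sub_distrib]
      abel
    have hpd : ∀ i : {i // p i ∉ range q}, (p.coord i).linear d = α (Sum.inl i) := by
      intro i
      have hi0i : (i : ι) ≠ i0 := by
        intro hh
        apply i.2
        rw [hh, hi0, ← hk0]; exact mem_range_self _
      rw [hd', map_sub, map_sum, map_sum]
      simp only [map_smul, ← hi0, coord_linear_sub, smul_eq_mul]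
      rw [p.coord_apply_ne hi0i]
      have h1 : ∑ x : {i // p i ∉ range q}, α (Sum.inl x) * (p.coord i (p x) - 0)
          = α (Sum.inl i) := by
        rw [Finset.sum_eq_single i]
        · rw [p.coord_apply_eq]; ring
        · intro b _ hb
          rw [p.coord_apply_ne (fun hh => hb (Subtype.ext hh.symm))]; ring
        · simp
      have h2 : ∑ x : {i // p i ∈ range q}, γ x * (p.coord i (p x) - 0) = 0 := by
        refine Finset.sum_eq_zero fun x _ => ?_
        rw [p.coord_apply_ne (fun hh => i.2 (by rw [hh]; exact x.2))]; ring
      rw [h1, h2, sub_zero]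
    have hqd : ∀ k : {k // q k ∉ range p}, (q.coord k).linear d = α (Sum.inr k) := by
      intro k
      have hk0k : (k : κ) ≠ k0 := by
        intro hh
        apply k.2
        rw [hh, hk0, ← hi0]; exact mem_range_self _
      rw [hd, map_sum]
      simp only [map_smul, ← hk0, coord_linear_sub, smul_eq_mul]
      rw [q.coord_apply_ne hk0k, Finset.sum_eq_single k]
      · rw [q.coord_apply_eq]; ring
      · intro b _ hb
        rw [q.coord_apply_ne (fun hh => hb (Subtype.ext hh.symm))]; ring
      · simp
    have hz := coord_linear_eq_zero_of_nonneg p q h ⟨v, ⟨i0, hi0⟩, ⟨k0, hk0⟩⟩ (d := d)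
      (fun i hi => by rw [hpd ⟨i, hi⟩]; exact hα0 _) (fun k hk => by rw [hqd ⟨k, hk⟩]; exact hα0 _)
    have hz1 : ∀ i, α (Sum.inl i) = 0 := fun i => by rw [← hpd i]; exact hz.1 i i.2
    have hz2 : ∀ k, α (Sum.inr k) = 0 := fun k => by rw [← hqd k]; exact hz.2 k k.2
    simp [hz1, hz2] at hα1
  obtain ⟨f, a, b, hfa, hab, hfb⟩ := geometric_hahn_banach_compact_closed
    (convex_convexHull ℝ (range r)) ((finite_range r).isCompact_convexHull ℝ) W.convex hWcl hdisj
  have hb0 : b < 0 := by simpa using hfb 0 W.zero_mem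
  -- A functional bounded below on a subspace vanishes there: otherwise some multiple of w attains
  -- the bound b itself.
  have hfW : ∀ w ∈ W, f w = 0 := by
    intro w hw
    by_contra hne
    have := hfb ((b / f w) • w) (W.smul_mem _ hw)
    rw [map_smul, smul_eq_mul, div_mul_cancel₀ _ hne] at this
    exact lt_irrefl _ this
  have hWmem : ∀ i, p i ∈ range q → p i - v ∈ W := fun i hi =>
    Submodule.subset_span ⟨⟨i, hi⟩, rfl⟩
  refine ⟨-f, -b, by linarith, fun i hi => ?_, fun i hi => ?_, fun k => ?_⟩
  · simp [hfW _ (hWmem i hi)]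
  · have := hfa (p i - v) (subset_convexHull ℝ _ ⟨Sum.inl ⟨i, hi⟩, rfl⟩)
    simp only [_root_.neg_apply]
    linarith
  · by_cases hk : q k ∈ range p
    · obtain ⟨i, hi⟩ := hk
      rw [← hi]
      simp [hfW _ (hWmem i (hi ▸ mem_range_self k))]
    · have := hfa (v - q k) (subset_convexHull ℝ _ ⟨Sum.inr ⟨k, hk⟩, rfl⟩)
      rw [← neg_sub, map_neg] at this
      simp only [_root_.neg_apply]
      linarith

theorem sub_eq_sum_coord_smul [Fintype ι] (p : AffineBasis ι ℝ E) (x v : E) :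
    x - v = ∑ i, p.coord i x • (p i - v) := by
  simp only [smul_sub, Finset.sum_sub_distrib, ← Finset.sum_smul, p.sum_coord_apply_eq_one,
    one_smul, p.linear_combination_coord_eq_self]

/-- Two simplexes that meet in a common nonempty face are linearly regularly situated. -/
theorem exists_mem_inter_norm_sub_le [Fintype ι] [Fintype κ]
    (p : AffineBasis ι ℝ E) (q : AffineBasis κ ℝ E)
    (h : convexHull ℝ (range p) ∩ convexHull ℝ (range q) = convexHull ℝ (range p ∩ range q))
    (hne : (convexHull ℝ (range p) ∩ convexHull ℝ (range q)).Nonempty) :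
    ∃ C : ℝ, 0 ≤ C ∧ ∀ x ∈ convexHull ℝ (range p), ∀ y ∈ convexHull ℝ (range q),
      ∃ z ∈ convexHull ℝ (range p) ∩ convexHull ℝ (range q), ‖x - z‖ ≤ C * ‖x - y‖ := by
  classical
  rw [h, convexHull_nonempty_iff] at hne
  obtain ⟨v, hvp, hvq⟩ := hne
  obtain ⟨f, c, hc, hf0, hfc, hfq⟩ := exists_separating p q h hvp hvq
  set M : ℝ := ∑ i, ‖p i - v‖ with hM
  have hM0 : 0 ≤ M := Finset.sum_nonneg fun _ _ => norm_nonneg _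
  refine ⟨M * (‖f‖ / c), by positivity, fun x hx y hy => ?_⟩
  have hx0 : ∀ i, 0 ≤ p.coord i x := by rwa [p.convexHull_eq_nonneg_coord] at hx
  have hy0 : ∀ k, 0 ≤ q.coord k y := by rwa [q.convexHull_eq_nonneg_coord] at hy
  -- s is the weight of x off the common face. The functional f controls it, since c s ≤ f (x - v)
  -- while f (y - v) ≤ 0.
  set s : ℝ := ∑ i, if p i ∈ range q then 0 else p.coord i x with hs
  have hs0 : 0 ≤ s := Finset.sum_nonneg fun i _ => by split_ifs <;> simp [hx0 i]
  have hsf : c * s ≤ ‖f‖ * ‖x - y‖ := by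
    have h1 : c * s ≤ f (x - v) := by
      rw [p.sub_eq_sum_coord_smul x v, map_sum, hs, Finset.mul_sum]
      refine Finset.sum_le_sum fun i _ => ?_
      rw [map_smul, smul_eq_mul]
      split_ifs with hi
      · simp [hf0 i hi]
      · rw [mul_comm]; exact mul_le_mul_of_nonneg_left (hfc i hi) (hx0 i)
    have h2 : f (y - v) ≤ 0 := by
      rw [q.sub_eq_sum_coord_smul y v, map_sum]
      refine Finset.sum_nonpos fun k _ => ?_
      rw [map_smul, smul_eq_mul]
      exact mul_nonpos_of_nonneg_of_nonpos (hy0 k) (hfq k)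
    have h3 : f (x - y) = f (x - v) - f (y - v) := by rw [← map_sub]; congr 1; abel
    have h4 := f.le_opNorm (x - y)
    have h5 := le_abs_self (f (x - y))
    rw [Real.norm_eq_abs] at h4
    linarith
  -- Moving the off-face weight of x to the shared vertex v gives a point of the face at distance at
  -- most s M from x.
  refine ⟨∑ i, p.coord i x • (if p i ∈ range q then p i else v), ?_, ?_⟩
  · rw [h]
    refine (convex_convexHull ℝ _).sum_mem (fun i _ => hx0 i) (p.sum_coord_apply_eq_one x)
      fun i _ => subset_convexHull ℝ _ ?_
    split_ifs with hi
    · exact ⟨mem_range_self i, hi⟩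
    · exact ⟨hvp, hvq⟩
  · have h1 : x - ∑ i, p.coord i x • (if p i ∈ range q then p i else v)
        = ∑ i, (if p i ∈ range q then 0 else p.coord i x) • (p i - v) := by
      nth_rw 1 [← p.linear_combination_coord_eq_self x]
      rw [← Finset.sum_sub_distrib]
      refine Finset.sum_congr rfl fun i _ => ?_
      split_ifs <;> simp [smul_sub]
    have h2 : ‖x - ∑ i, p.coord i x • (if p i ∈ range q then p i else v)‖ ≤ s * M := by
      rw [h1, hs, Finset.sum_mul]
      refine (norm_sum_le _ _).trans (Finset.sum_le_sum fun i _ => ?_)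
      have h3 : (0 : ℝ) ≤ if p i ∈ range q then 0 else p.coord i x := by
        split_ifs <;> simp [hx0 i]
      rw [norm_smul, Real.norm_of_nonneg h3]
      exact mul_le_mul_of_nonneg_left
        (Finset.single_le_sum (f := fun i => ‖p i - v‖) (fun _ _ => norm_nonneg _)
          (Finset.mem_univ i)) h3
    have h3 : s ≤ ‖f‖ / c * ‖x - y‖ := by
      rw [div_mul_eq_mul_div, le_div_iff₀ hc, mul_comm]; exact hsf
    calc _ ≤ s * M := h2
      _ ≤ ‖f‖ / c * ‖x - y‖ * M := mul_le_mul_of_nonneg_right h3 hM0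
      _ = _ := by ring

end AffineBasis

/-! ### Geometry of the triangulation and properties of the CPA interpolation. -/

namespace CPA

namespace Triangulation

variable {n : ℕ} (T : Triangulation n)

/-- The vertices of a simplex of the triangulation as an affine basis. -/
noncomputable def basis (i : Fin T.card) : AffineBasis (Fin (n + 1)) ℝ (State n) :=
  ⟨T.vert i, T.affineIndependent i, by
    rw [(T.affineIndependent i).affineSpan_eq_top_iff_card_eq_finrank_add_one]; simp⟩

theorem coe_basis (i : Fin T.card) : ⇑(T.basis i) = T.vert i := rfl

theorem exists_weights {i : Fin T.card} {x : State n} (hx : x ∈ T.simplex i) :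
    ∃ w : Fin (n + 1) → ℝ, (∀ j, 0 ≤ w j) ∧ ∑ j, w j = 1 ∧ ∑ j, w j • T.vert i j = x := by
  refine ⟨fun j => (T.basis i).coord j x, ?_, (T.basis i).sum_coord_apply_eq_one x,
    (T.basis i).linear_combination_coord_eq_self x⟩
  have h := (T.basis i).convexHull_eq_nonneg_coord
  rw [coe_basis] at h
  have h2 : x ∈ convexHull ℝ (range (T.vert i)) := hx
  rw [h] at h2
  exact h2

theorem convex_simplex (i : Fin T.card) : Convex ℝ (T.simplex i) := convex_convexHull ℝ _

theorem isCompact_simplex (i : Fin T.card) : IsCompact (T.simplex i) :=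
  (finite_range _).isCompact_convexHull ℝ

theorem vert_mem_simplex (i : Fin T.card) (j : Fin (n + 1)) : T.vert i j ∈ T.simplex i :=
  subset_convexHull ℝ _ (mem_range_self j)

theorem uniqueDiffOn_simplex (i : Fin T.card) : UniqueDiffOn ℝ (T.simplex i) := by
  refine uniqueDiffOn_convex (T.convex_simplex i) ?_
  rw [simplex, interior_convexHull_nonempty_iff_affineSpan_eq_top]
  exact (T.basis i).tot

theorem simplex_subset_carrier (i : Fin T.card) : T.simplex i ⊆ T.carrier :=
  subset_iUnion _ i

theorem isCompact_carrier : IsCompact T.carrier := isCompact_iUnion T.isCompact_simplex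

theorem zero_mem_interior_carrier : (0 : State n) ∈ interior T.carrier := T.union_mem.2.2.1

theorem zero_mem_carrier : (0 : State n) ∈ T.carrier := interior_subset T.zero_mem_interior_carrier

theorem origin_eq_vtx {i : Fin T.card} (hi : (0 : State n) ∈ T.simplex i) :
    T.vtx i 0 = T.origin := Subtype.ext (T.vert_zero i hi)

theorem eq_zero_of_vert_eq_zero {i : Fin T.card} {j : Fin (n + 1)} (h : T.vert i j = 0) :
    j = 0 := by
  have h0 : T.vert i 0 = 0 := T.vert_zero i (h ▸ T.vert_mem_simplex i j)
  exact (T.affineIndependent i).injective (h.trans h0.symm)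

/-- The finitely many simplexes that miss x are closed, so they miss a neighbourhood of x. This lets
V be compared at x and at a nearby point within a single affine piece. -/
theorem eventually_mem_simplex (x : State n) :
    ∀ᶠ y in 𝓝 x, ∀ i, y ∈ T.simplex i → x ∈ T.simplex i := by
  refine eventually_all.2 fun i => ?_
  by_cases hx : x ∈ T.simplex i
  · exact Eventually.of_forall fun _ _ => hx
  · filter_upwards [(T.isCompact_simplex i).isClosed.isOpen_compl.mem_nhds hx] with y hy h
    exact absurd h hy

/-- A continuous function on the triangulation which is Lipschitz on each simplex is Lipschitz. -/
theorem exists_lipschitzOnWith_carrier {φ : State n → ℝ} (hφ : ContinuousOn φ T.carrier)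
    (h : ∀ i, ∃ K, LipschitzOnWith K φ (T.simplex i)) : ∃ K, LipschitzOnWith K φ T.carrier := by
  choose K hK using h
  have hK' : ∀ i, ∀ x ∈ T.simplex i, ∀ y ∈ T.simplex i, |φ x - φ y| ≤ K i * ‖x - y‖ := by
    intro i x hx y hy
    have := (hK i).dist_le_mul x hx y hy
    rwa [Real.dist_eq, dist_eq_norm] at this
  obtain ⟨M, hM⟩ := T.isCompact_carrier.exists_bound_of_continuousOn hφ
  -- Segments may leave the triangulation, so pairs of simplexes are treated separately: if they
  -- meet, the path detours through a point z of the common face; if not, they have positive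
  -- distance and boundedness of φ suffices.
  have pair : ∀ i k, ∃ C : ℝ, 0 ≤ C ∧ ∀ x ∈ T.simplex i, ∀ y ∈ T.simplex k,
      |φ x - φ y| ≤ C * ‖x - y‖ := by
    intro i k
    by_cases hne : (T.simplex i ∩ T.simplex k).Nonempty
    · obtain ⟨C, hC, hz⟩ := (T.basis i).exists_mem_inter_norm_sub_le (T.basis k)
        (T.inter_face i k) hne
      refine ⟨K i * C + K k * (C + 1), by positivity, fun x hx y hy => ?_⟩
      obtain ⟨z, ⟨hzi, hzk⟩, hxz⟩ := hz x hx y hy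
      have h1 := hK' i x hx z hzi
      have h2 := hK' k z hzk y hy
      have h3 : ‖z - y‖ ≤ (C + 1) * ‖x - y‖ := by
        have : z - y = (x - y) - (x - z) := by abel
        rw [this]
        have := norm_sub_le (x - y) (x - z)
        linarith
      have h4 : |φ x - φ y| ≤ |φ x - φ z| + |φ z - φ y| := abs_sub_le _ _ _
      have h5 : (K i : ℝ) * ‖x - z‖ ≤ K i * (C * ‖x - y‖) :=
        mul_le_mul_of_nonneg_left hxz (K i).2
      have h6 : (K k : ℝ) * ‖z - y‖ ≤ K k * ((C + 1) * ‖x - y‖) :=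
        mul_le_mul_of_nonneg_left h3 (K k).2
      linarith
    · have hdisj : Disjoint (T.simplex i) (T.simplex k) := by
        rwa [Set.disjoint_iff_inter_eq_empty, ← Set.not_nonempty_iff_eq_empty]
      obtain ⟨δ, hδ, hd⟩ := Metric.exists_pos_forall_lt_edist (T.isCompact_simplex i)
        (T.isCompact_simplex k).isClosed hdisj
      refine ⟨2 * |M| / δ, by positivity, fun x hx y hy => ?_⟩
      have h1 := hM x (T.simplex_subset_carrier i hx)
      have h2 := hM y (T.simplex_subset_carrier k hy)
      have h3 : (δ : ℝ) ≤ ‖x - y‖ := by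
        have := hd x hx y hy
        rw [edist_nndist] at this
        have h4 : δ < nndist x y := by exact_mod_cast this
        rw [← dist_eq_norm]
        exact_mod_cast h4.le
      have hδ' : (0 : ℝ) < δ := hδ
      rw [Real.norm_eq_abs] at h1 h2
      have h4 : |φ x - φ y| ≤ 2 * |M| := by
        have := abs_sub (φ x) (φ y)
        have := le_abs_self M
        linarith
      rw [div_mul_eq_mul_div, le_div_iff₀ hδ']
      exact mul_le_mul h4 h3 hδ'.le (by positivity)
  choose C hC0 hC using pair
  refine ⟨⟨∑ i, ∑ k, C i k, Finset.sum_nonneg fun i _ => Finset.sum_nonneg fun k _ => hC0 i k⟩,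
    LipschitzOnWith.of_dist_le_mul fun x hx y hy => ?_⟩
  obtain ⟨i, hi⟩ := mem_iUnion.1 hx
  obtain ⟨k, hk⟩ := mem_iUnion.1 hy
  rw [Real.dist_eq, dist_eq_norm]
  refine (hC i k x hi y hk).trans (mul_le_mul_of_nonneg_right ?_ (norm_nonneg _))
  have h1 := Finset.single_le_sum (f := fun i => ∑ k, C i k)
    (fun i _ => Finset.sum_nonneg fun k _ => hC0 i k) (Finset.mem_univ i)
  have h2 := Finset.single_le_sum (f := fun k => C i k) (fun k _ => hC0 i k) (Finset.mem_univ k)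
  exact h2.trans h1

/-! ### The interpolation -/

/-- The gradient of the interpolation on a simplex as a linear functional. -/
noncomputable def gradCLM (i : Fin T.card) (W : T.vertices → ℝ) : State n →L[ℝ] ℝ :=
  ∑ k, T.grad i W k • EuclideanSpace.proj k

theorem gradCLM_apply (i : Fin T.card) (W : T.vertices → ℝ) (d : State n) :
    T.gradCLM i W d = T.grad i W ⬝ᵥ d.ofLp := by
  simp [gradCLM, dotProduct]

theorem piece_sub_piece (i : Fin T.card) (W : T.vertices → ℝ) (x y : State n) :
    T.piece i W x - T.piece i W y = T.gradCLM i W (x - y) := by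
  rw [gradCLM_apply]
  simp only [piece, dotProduct, add_sub_add_left_eq_sub, ← Finset.sum_sub_distrib]
  exact Finset.sum_congr rfl fun k _ => by simp; ring

theorem piece_eq (i : Fin T.card) (W : T.vertices → ℝ) :
    T.piece i W = fun x => T.gradCLM i W x + T.piece i W 0 := by
  funext x
  have := T.piece_sub_piece i W x 0
  rw [sub_zero] at this
  linarith

theorem hasFDerivAt_piece (i : Fin T.card) (W : T.vertices → ℝ) (x : State n) :
    HasFDerivAt (T.piece i W) (T.gradCLM i W) x := by
  rw [piece_eq]
  exact (T.gradCLM i W).hasFDerivAt.add_const _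

theorem contDiff_piece (i : Fin T.card) (W : T.vertices → ℝ) {k : WithTop ℕ∞} :
    ContDiff ℝ k (T.piece i W) := by
  rw [piece_eq]
  exact (T.gradCLM i W).contDiff.add contDiff_const

theorem piece_sum (i : Fin T.card) (W : T.vertices → ℝ) {w : Fin (n + 1) → ℝ}
    (hw : ∑ j, w j = 1) :
    T.piece i W (∑ j, w j • T.vert i j) = ∑ j, w j * W (T.vtx i j) := by
  rw [piece_eq]
  simp only [map_sum, map_smul, smul_eq_mul]
  have h : ∀ j, T.gradCLM i W (T.vert i j) = W (T.vtx i j) - T.piece i W 0 := by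
    intro j
    have := congrFun (T.piece_eq i W) (T.vert i j)
    rw [T.piece_vtx] at this
    linarith
  simp only [h, mul_sub, Finset.sum_sub_distrib, ← Finset.sum_mul, hw, one_mul, sub_add_cancel]

theorem interp_eqOn (i : Fin T.card) (W : T.vertices → ℝ) :
    EqOn (T.interp W) (T.piece i W) (T.simplex i) := fun x hx => T.interp_eq_piece i W x hx

theorem interp_vert (i : Fin T.card) (j : Fin (n + 1)) (W : T.vertices → ℝ) :
    T.interp W (T.vert i j) = W (T.vtx i j) := by
  rw [T.interp_eq_piece i W _ (T.vert_mem_simplex i j), T.piece_vtx]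

theorem interp_zero (W : T.vertices → ℝ) : T.interp W 0 = W T.origin := by
  obtain ⟨i, hi⟩ := mem_iUnion.1 T.zero_mem_carrier
  have h := T.interp_vert i 0 W
  rw [T.origin_eq_vtx hi, T.vert_zero i hi] at h
  exact h

theorem continuousOn_interp (W : T.vertices → ℝ) : ContinuousOn (T.interp W) T.carrier := by
  refine (locallyFinite_of_finite _).continuousOn_iUnion
    (fun i => (T.isCompact_simplex i).isClosed) fun i => ?_
  exact ((T.contDiff_piece i W (k := 1)).continuous.continuousOn).congr (T.interp_eqOn i W)

theorem exists_lipschitzOnWith_interp (W : T.vertices → ℝ) :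
    ∃ K, LipschitzOnWith K (T.interp W) T.carrier := by
  refine T.exists_lipschitzOnWith_carrier (T.continuousOn_interp W) fun i =>
    ⟨‖T.gradCLM i W‖₊, LipschitzOnWith.of_dist_le_mul fun x hx y hy => ?_⟩
  rw [T.interp_eqOn i W hx, T.interp_eqOn i W hy, Real.dist_eq, T.piece_sub_piece, dist_eq_norm]
  exact (T.gradCLM i W).le_opNorm _

/-- One set of weights serves all W, so V and every component of u are averaged in the same way. -/
theorem exists_interp_eq_sum {i : Fin T.card} {x : State n} (hx : x ∈ T.simplex i) :
    ∃ w : Fin (n + 1) → ℝ, (∀ j, 0 ≤ w j) ∧ ∑ j, w j = 1 ∧ ∑ j, w j • T.vert i j = x ∧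
      ∀ W, T.interp W x = ∑ j, w j * W (T.vtx i j) := by
  obtain ⟨w, h0, h1, h2⟩ := T.exists_weights hx
  refine ⟨w, h0, h1, h2, fun W => ?_⟩
  rw [T.interp_eqOn i W hx, ← h2, T.piece_sum i W h1]

/-- Convex lower bounds pass from the vertices to the interpolation. -/
theorem le_interp_of_convexOn {ψ : State n → ℝ} (hψ : ConvexOn ℝ univ ψ) {W : T.vertices → ℝ}
    (h : ∀ v : T.vertices, ψ v ≤ W v) {x : State n} (hx : x ∈ T.carrier) : ψ x ≤ T.interp W x := by
  obtain ⟨i, hi⟩ := mem_iUnion.1 hx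
  obtain ⟨w, h0, h1, h2, h3⟩ := T.exists_interp_eq_sum hi
  rw [h3, ← h2]
  refine (hψ.map_sum_le (fun j _ => h0 j) h1 fun _ _ => mem_univ _).trans ?_
  refine Finset.sum_le_sum fun j _ => mul_le_mul_of_nonneg_left (h (T.vtx i j)) (h0 j)

theorem finite_vertices : T.vertices.Finite := by
  refine (finite_range fun p : Fin T.card × Fin (n + 1) => T.vert p.1 p.2).subset ?_
  rintro x ⟨i, j, rfl⟩
  exact ⟨(i, j), rfl⟩

/-- The gradient as a linear function of the vertex values. -/
noncomputable def gradLinear (i : Fin T.card) : (T.vertices → ℝ) →ₗ[ℝ] (Fin n → ℝ) where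
  toFun W := T.grad i W
  map_add' W W' := by
    rw [grad, grad, grad, ← mulVec_add]
    congr 1
    funext j
    simp only [Pi.add_apply]
    ring
  map_smul' a W := by
    rw [RingHom.id_apply, grad, grad, ← mulVec_smul]
    congr 1
    funext j
    simp only [Pi.smul_apply, smul_eq_mul]
    ring

theorem grad_eq_gradLinear (i : Fin T.card) (W : T.vertices → ℝ) :
    T.grad i W = T.gradLinear i W := rfl

end Triangulation

/-! ### The constraints: feasibility, linear structure and first consequences. -/

namespace ControlSystem

variable {n m p : ℕ} (S : ControlSystem n m p) {T : Triangulation n}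

theorem isGreatest_inputBound (hU : S.inputs ∈ regularSets (Fin m → ℝ)) (s : Fin m) :
    IsGreatest ((fun u : Fin m → ℝ => |u s|) '' S.inputs) (S.inputBound s) := by
  have hne : S.inputs.Nonempty := ⟨0, interior_subset hU.2.2.1⟩
  exact (hU.1.image (by fun_prop)).isGreatest_sSup (hne.image _)

theorem convex_inputs : Convex ℝ S.inputs := by
  intro u hu v hv a b ha hb hab k
  have h1 := mul_le_mul_of_nonneg_left (hu k) ha
  have h2 := mul_le_mul_of_nonneg_left (hv k) hb
  simp only [mulVec_add, mulVec_smul, Pi.add_apply, Pi.smul_apply, smul_eq_mul]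
  have h3 : a * S.hc k + b * S.hc k = S.hc k := by rw [← add_mul, hab, one_mul]
  linarith

/-- The sign of b₂ is unconstrained and D⁺ does not involve b₂. With V the norm and zero input, a
suitable b₂ = -B meets the finitely many decrease constraints. -/
theorem exists_feasible (hU : S.inputs ∈ regularSets (Fin m → ℝ)) (hf0 : S.f 0 = 0) :
    ∃ y : Unknowns T m, S.Feasible y := by
  classical
  let y₀ : Unknowns T m := ⟨fun v => ‖(v : State n)‖,
    fun i k => |T.grad i (fun v => ‖(v : State n)‖) k|,
    fun _ => 0, fun _ => 0, 1, 1, 0⟩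
  obtain ⟨B, hB⟩ : ∃ B : ℝ, ∀ i j, T.vert i j ≠ 0 → S.dplus y₀ i j ≤ B * ‖T.vert i j‖ := by
    obtain ⟨B, hB⟩ := (finite_range fun q : Fin T.card × Fin (n + 1) =>
      S.dplus y₀ q.1 q.2 / ‖T.vert q.1 q.2‖).bddAbove
    refine ⟨B, fun i j h => ?_⟩
    rw [← div_le_iff₀ (norm_pos_iff.2 h)]
    exact hB ⟨(i, j), rfl⟩
  refine ⟨{ y₀ with b₂ := -B }, ?_⟩
  constructor
  · simp [y₀, Triangulation.origin]
  · exact one_pos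
  · exact one_pos
  · intro v _
    simp [y₀]
  · intro i k
    exact le_rfl
  · rfl
  · intro v _
    exact interior_subset hU.2.2.1
  · intro i s k
    simp only [y₀, Pi.zero_apply]
    rw [T.grad_eq_gradLinear]
    have : (fun _ : T.vertices => (0 : ℝ)) = 0 := rfl
    rw [this, map_zero]
    simp
  · intro i j
    change S.dplus y₀ i j ≤ - -B * ‖T.vert i j‖
    rw [neg_neg]
    -- At the origin b₂ is of no help, but both sides vanish: f(0) = 0, the input is zero and
    -- c_{i,0} = 0.
    by_cases h : T.vert i j = 0
    · have hj := T.eq_zero_of_vert_eq_zero h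
      subst hj
      rw [h, norm_zero, mul_zero]
      simp [dplus, phi, h, hf0, Triangulation.c, y₀]
    · exact hB i j h

theorem exists_linear_decomposition (i : Fin T.card) (j : Fin (n + 1)) :
    ∃ (Φ : ((T.vertices → ℝ) × (Fin T.card → Fin n → ℝ)) →ₗ[ℝ] ℝ)
      (B : ((T.vertices → Fin m → ℝ) × (Fin T.card → ℝ)) →ₗ[ℝ]
        ((T.vertices → ℝ) × (Fin T.card → Fin n → ℝ)) →ₗ[ℝ] ℝ),
      ∀ y : Unknowns T m, S.phi y i j = Φ (y.V, y.l) ∧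
        S.dplus y i j = S.phi y i j + B (y.u, y.z) (y.V, y.l) := by
  refine ⟨IsLinearMap.mk' (fun q => (S.f (T.vert i j)).ofLp ⬝ᵥ T.gradLinear i q.1
      + T.c i j * S.mu T i * ∑ k, q.2 i k) ⟨?_, ?_⟩,
    LinearMap.mk₂ ℝ (fun r q => (S.G (T.vert i j) *ᵥ r.1 (T.vtx i j)) ⬝ᵥ T.gradLinear i q.1
      + T.c i j * S.eta T i * r.2 i * ∑ k, q.2 i k) ?_ ?_ ?_ ?_, fun y => ⟨rfl, ?_⟩⟩
  · intro a b
    simp only [Prod.fst_add, Prod.snd_add, map_add, dotProduct_add, Pi.add_apply,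
      Finset.sum_add_distrib]
    ring
  · intro a b
    simp only [Prod.smul_fst, Prod.smul_snd, map_smul, dotProduct_smul, Pi.smul_apply, smul_eq_mul,
      ← Finset.mul_sum]
    ring
  · intro a b q
    simp only [Prod.fst_add, Prod.snd_add, Pi.add_apply, mulVec_add, add_dotProduct]
    ring
  · intro a b q
    simp only [Prod.smul_fst, Prod.smul_snd, Pi.smul_apply, mulVec_smul, smul_dotProduct,
      smul_eq_mul]
    ring
  · intro r a b
    simp only [Prod.fst_add, Prod.snd_add, map_add, dotProduct_add, Pi.add_apply,
      Finset.sum_add_distrib]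
    ring
  · intro a r b
    simp only [Prod.smul_fst, Prod.smul_snd, map_smul, dotProduct_smul, Pi.smul_apply, smul_eq_mul,
      ← Finset.mul_sum]
    ring
  · rw [dplus, add_assoc]; rfl

variable {S}

variable {y : Unknowns T m}

theorem Feasible.ctrl_mem (hy : S.Feasible y) (hU : S.inputs ∈ regularSets (Fin m → ℝ))
    {x : State n} (hx : x ∈ T.carrier) : y.ctrl x ∈ S.inputs := by
  obtain ⟨i, hi⟩ := mem_iUnion.1 hx
  obtain ⟨w, h0, h1, -, h3⟩ := T.exists_interp_eq_sum hi
  have h : y.ctrl x = ∑ j, w j • y.u (T.vtx i j) := by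
    funext s
    simp [Unknowns.ctrl, h3]
  rw [h]
  refine S.convex_inputs.sum_mem (fun j _ => h0 j) h1 fun j _ => ?_
  by_cases hv : T.vert i j = 0
  · have : T.vtx i j = T.origin := Subtype.ext hv
    rw [this, hy.u_zero]
    exact interior_subset hU.2.2.1
  · exact hy.u_mem (T.vtx i j) hv

theorem ctrl_vert (y : Unknowns T m) (i : Fin T.card) (j : Fin (n + 1)) :
    y.ctrl (T.vert i j) = y.u (T.vtx i j) := by
  funext s
  exact T.interp_vert i j _

theorem Feasible.ctrl_zero (hy : S.Feasible y) : y.ctrl 0 = 0 := by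
  funext s
  simp [Unknowns.ctrl, T.interp_zero, hy.u_zero]

theorem Feasible.closedLoop_zero (hy : S.Feasible y) (hf0 : S.f 0 = 0) :
    S.closedLoop y 0 = 0 := by
  simp [closedLoop, hf0, hy.ctrl_zero]

theorem Feasible.lyap_zero (hy : S.Feasible y) : y.lyap 0 = 0 := by
  rw [Unknowns.lyap, T.interp_zero, hy.V_zero]

theorem dplus_eq (y : Unknowns T m) (i : Fin T.card) (j : Fin (n + 1)) :
    S.dplus y i j = (S.closedLoop y (T.vert i j)).ofLp ⬝ᵥ T.grad i y.V +
      T.c i j * (S.mu T i + S.eta T i * y.z i) * ∑ k, y.l i k := by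
  simp only [dplus, phi, closedLoop, ctrl_vert, WithLp.ofLp_add, add_dotProduct]
  ring

/-- For a ≥ 1 the function b₁‖x‖^a is convex, so the vertex constraint passes to the interpolation.
-/
theorem Feasible.rpow_le_lyap (hy : S.Feasible y) (ha : 1 ≤ y.a) {x : State n}
    (hx : x ∈ T.carrier) : y.b₁ * ‖x‖ ^ y.a ≤ y.lyap x := by
  have hc : ConvexOn ℝ univ fun x : State n => y.b₁ * ‖x‖ ^ y.a := by
    have h1 : ConvexOn ℝ univ fun x : State n => ‖x‖ ^ y.a := by
      refine ⟨convex_univ, fun x _ z _ a b ha' hb hab => ?_⟩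
      have h2 := (convexOn_rpow ha).2 (norm_nonneg x) (norm_nonneg z) ha' hb hab
      refine le_trans (Real.rpow_le_rpow (norm_nonneg _) ?_ (by linarith)) h2
      refine (norm_add_le _ _).trans ?_
      simp [norm_smul, abs_of_nonneg ha', abs_of_nonneg hb]
    exact h1.smul hy.b₁_pos.le
  refine T.le_interp_of_convexOn hc (fun v => ?_) hx
  by_cases hv : (v : State n) = 0
  · have : v = T.origin := Subtype.ext hv
    rw [this, hy.V_zero]
    simp [Triangulation.origin, Real.zero_rpow hy.a_pos.ne']
  · exact hy.V_lower v hv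

/-- For a < 1 convexity fails, but V is positive at each of the finitely many nonzero vertices, so a
multiple of the norm with small enough slope lies below V at the vertices, and the norm is convex.
-/
theorem Feasible.exists_mul_norm_le_lyap (hy : S.Feasible y) :
    ∃ b > 0, ∀ x ∈ T.carrier, b * ‖x‖ ≤ y.lyap x := by
  obtain ⟨b, hb, h⟩ : ∃ b > 0, ∀ v : T.vertices, b * ‖(v : State n)‖ ≤ y.V v := by
    have : Finite T.vertices := T.finite_vertices
    have : ∀ v : T.vertices, ∀ᶠ b in 𝓝[>] (0 : ℝ), b * ‖(v : State n)‖ ≤ y.V v := by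
      intro v
      by_cases hv : (v : State n) = 0
      · have : v = T.origin := Subtype.ext hv
        rw [this, hy.V_zero]
        simp [Triangulation.origin]
      · have hpos : 0 < y.V v :=
          lt_of_lt_of_le (mul_pos hy.b₁_pos (Real.rpow_pos_of_pos (norm_pos_iff.2 hv) _))
            (hy.V_lower v hv)
        have hcont : Tendsto (fun b : ℝ => b * ‖(v : State n)‖) (𝓝[>] 0) (𝓝 0) := by
          have : Continuous fun b : ℝ => b * ‖(v : State n)‖ := by fun_prop
          have h0 := this.tendsto 0
          rw [zero_mul] at h0
          exact h0.mono_left nhdsWithin_le_nhds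
        filter_upwards [hcont.eventually (gt_mem_nhds hpos)] with b hb using hb.le
    obtain ⟨b, hb, hpos⟩ := ((eventually_all.2 this).and self_mem_nhdsWithin).exists
    exact ⟨b, hpos, hb⟩
  refine ⟨b, hb, fun x hx => ?_⟩
  have hc : ConvexOn ℝ univ fun x : State n => b * ‖x‖ := convexOn_univ_norm.smul hb.le
  exact T.le_interp_of_convexOn hc h hx

end ControlSystem

end CPA

/-! ### Attained maxima, and calculus of partial derivatives within a set. -/

theorem isGreatest_sSup_iUnion_image {ι E : Type*} [Finite ι] [Nonempty ι] [TopologicalSpace E]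
    {σ : Set E} (hσ : IsCompact σ) (hne : σ.Nonempty) {F : ι → E → ℝ}
    (hF : ∀ i, ContinuousOn (F i) σ) {A : Set ℝ} (hA : A = ⋃ i, F i '' σ) :
    IsGreatest A (sSup A) := by
  subst hA
  refine (isCompact_iUnion fun i => hσ.image_of_continuousOn (hF i)).isGreatest_sSup ?_
  obtain ⟨x, hx⟩ := hne
  exact ⟨_, mem_iUnion.2 ⟨Classical.arbitrary ι, mem_image_of_mem _ hx⟩⟩

namespace CPA

section PartialDerivatives

variable {n : ℕ} {σ : Set (State n)} {φ ψ : State n → ℝ}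

theorem partialD_congr (h : EqOn φ ψ σ) (q : Fin n) : EqOn (partialD σ φ q) (partialD σ ψ q) σ := by
  intro ξ hξ
  rw [partialD, partialD, fderivWithin_congr h (h hξ)]

theorem partialD_add (hσ : UniqueDiffOn ℝ σ) {ξ : State n} (hξ : ξ ∈ σ)
    (hφ : DifferentiableWithinAt ℝ φ σ ξ) (hψ : DifferentiableWithinAt ℝ ψ σ ξ) (q : Fin n) :
    partialD σ (fun x => φ x + ψ x) q ξ = partialD σ φ q ξ + partialD σ ψ q ξ := by
  rw [partialD, fderivWithin_fun_add (hσ ξ hξ) hφ hψ]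
  rfl

theorem partialD_mul (hσ : UniqueDiffOn ℝ σ) {ξ : State n} (hξ : ξ ∈ σ)
    (hφ : DifferentiableWithinAt ℝ φ σ ξ) (hψ : DifferentiableWithinAt ℝ ψ σ ξ) (q : Fin n) :
    partialD σ (fun x => φ x * ψ x) q ξ = partialD σ φ q ξ * ψ ξ + φ ξ * partialD σ ψ q ξ := by
  rw [partialD, fderivWithin_fun_mul (hσ ξ hξ) hφ hψ]
  simp [partialD]
  ring

theorem partialD_mul_const (hσ : UniqueDiffOn ℝ σ) {ξ : State n} (hξ : ξ ∈ σ)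
    (hφ : DifferentiableWithinAt ℝ φ σ ξ) (a : ℝ) (q : Fin n) :
    partialD σ (fun x => φ x * a) q ξ = partialD σ φ q ξ * a := by
  rw [partialD_mul hσ hξ hφ (differentiableWithinAt_const a), partialD, partialD,
    fderivWithin_const_apply]
  simp

theorem partialD_sum {ι : Type*} (s : Finset ι) {φ : ι → State n → ℝ} (hσ : UniqueDiffOn ℝ σ)
    {ξ : State n} (hξ : ξ ∈ σ) (hφ : ∀ j ∈ s, DifferentiableWithinAt ℝ (φ j) σ ξ) (q : Fin n) :
    partialD σ (fun x => ∑ j ∈ s, φ j x) q ξ = ∑ j ∈ s, partialD σ (φ j) q ξ := by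
  rw [partialD, fderivWithin_fun_sum (hσ ξ hξ) hφ]
  simp [partialD]

theorem contDiffOn_partialD (hσ : UniqueDiffOn ℝ σ) (hφ : ContDiffOn ℝ 2 φ σ) (q : Fin n) :
    ContDiffOn ℝ 1 (partialD σ φ q) σ :=
  (hφ.fderivWithin hσ (m := 1) (by norm_num [one_add_one_eq_two])).clm_apply contDiffOn_const

theorem continuousOn_partialD2 (hσ : UniqueDiffOn ℝ σ) (hφ : ContDiffOn ℝ 2 φ σ) (q r : Fin n) :
    ContinuousOn (partialD2 σ φ q r) σ :=
  ((contDiffOn_partialD hσ hφ r).continuousOn_fderivWithin hσ le_rfl).clm_apply continuousOn_const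

theorem fderivWithin_eq_sum_partialD (ξ d : State n) :
    fderivWithin ℝ φ σ ξ d = ∑ q, d q * partialD σ φ q ξ := by
  have h : d = ∑ q, d q • EuclideanSpace.single q (1 : ℝ) := by
    ext k
    simp [Finset.sum_apply, Pi.single_apply]
  conv_lhs => rw [h]
  simp only [map_sum, map_smul, smul_eq_mul, partialD]

/-- Cauchy–Schwarz; this is the source of the factor n in c_{i,j}. -/
theorem sq_sum_abs_le (d : State n) : (∑ q, |d q|) * (∑ q, |d q|) ≤ n * ‖d‖ ^ 2 := by
  have h := sq_sum_le_card_mul_sum_sq (s := Finset.univ) (f := fun q => |d q|)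
  rw [EuclideanSpace.norm_sq_eq]
  simpa [pow_two] using h

/-- Taylor's formula of first order on a convex set, with a bound on the second partial
derivatives. -/
theorem abs_sub_sub_fderivWithin_le (hσ : UniqueDiffOn ℝ σ) (hconv : Convex ℝ σ)
    (hφ : ContDiffOn ℝ 2 φ σ) {β : ℝ} (hβ : ∀ q r, ∀ ξ ∈ σ, |partialD2 σ φ q r ξ| ≤ β)
    {x₀ x : State n} (hx₀ : x₀ ∈ σ) (hx : x ∈ σ) :
    |φ x - φ x₀ - fderivWithin ℝ φ σ x₀ (x - x₀)| ≤ n * β / 2 * ‖x - x₀‖ ^ 2 := by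
  set d := x - x₀ with hd
  set γ : ℝ → State n := fun t => x₀ + t • d with hγ
  have hγσ : ∀ t ∈ Icc (0 : ℝ) 1, γ t ∈ σ := fun t ht =>
    hconv.add_smul_sub_mem hx₀ hx ht
  have hγ' : ∀ t, HasDerivWithinAt γ d (Icc 0 1) t := fun t => by
    have := ((hasDerivAt_id t).smul_const d).const_add x₀
    simp only [one_smul] at this
    exact this.hasDerivWithinAt
  have hφ' : ∀ t ∈ Icc (0 : ℝ) 1,
      HasDerivWithinAt (fun t => φ (γ t)) (fderivWithin ℝ φ σ (γ t) d) (Icc 0 1) t := by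
    intro t ht
    have h1 := (hφ.differentiableOn (by norm_num) (γ t) (hγσ t ht)).hasFDerivWithinAt
    exact h1.comp_hasDerivWithinAt t (hγ' t) hγσ
  have hφ'' : ∀ t ∈ Icc (0 : ℝ) 1,
      HasDerivWithinAt (fun t => fderivWithin ℝ φ σ (γ t) d)
        (∑ r, d r * ∑ q, d q * partialD2 σ φ q r (γ t)) (Icc 0 1) t := by
    intro t ht
    simp only [fderivWithin_eq_sum_partialD (φ := φ)]
    refine HasDerivWithinAt.fun_sum fun r _ => HasDerivWithinAt.const_mul _ ?_
    have h1 := ((contDiffOn_partialD hσ hφ r).differentiableOn (by norm_num) (γ t)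
      (hγσ t ht)).hasFDerivWithinAt
    have h2 := h1.comp_hasDerivWithinAt t (hγ' t) hγσ
    rw [fderivWithin_eq_sum_partialD] at h2
    exact h2
  have hbound : ∀ t ∈ Ico (0 : ℝ) 1,
      ‖∑ r, d r * ∑ q, d q * partialD2 σ φ q r (γ t)‖ ≤ n * β * ‖d‖ ^ 2 := by
    intro t ht
    rcases Nat.eq_zero_or_pos n with rfl | hn
    · simp
    have hβ0 : 0 ≤ β := (abs_nonneg _).trans (hβ ⟨0, hn⟩ ⟨0, hn⟩ x₀ hx₀)
    calc ‖∑ r, d r * ∑ q, d q * partialD2 σ φ q r (γ t)‖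
        ≤ ∑ r, |d r| * ∑ q, |d q| * β := by
          refine (norm_sum_le _ _).trans (Finset.sum_le_sum fun r _ => ?_)
          rw [norm_mul]
          refine mul_le_mul_of_nonneg_left ((norm_sum_le _ _).trans
            (Finset.sum_le_sum fun q _ => ?_)) (norm_nonneg _)
          rw [norm_mul]
          exact mul_le_mul_of_nonneg_left (hβ q r _ (hγσ t (Ico_subset_Icc_self ht)))
            (norm_nonneg _)
      _ = (∑ q, |d q|) * (∑ q, |d q|) * β := by
          rw [← Finset.sum_mul, ← Finset.sum_mul]; ring
      _ ≤ n * ‖d‖ ^ 2 * β := mul_le_mul_of_nonneg_right (sq_sum_abs_le d) hβ0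
      _ = n * β * ‖d‖ ^ 2 := by ring
  -- Along the segment γ, the mean value inequality bounds the change of the first derivative
  -- linearly in t. A second integration, against the comparison function in `hB`, produces the
  -- factor 1/2.
  have h1 := norm_image_sub_le_of_norm_deriv_le_segment' hφ'' hbound
  have hright : ∀ t ∈ Ico (0 : ℝ) 1, HasDerivWithinAt
      (fun t => φ (γ t) - φ x₀ - t * fderivWithin ℝ φ σ (γ 0) d)
      (fderivWithin ℝ φ σ (γ t) d - fderivWithin ℝ φ σ (γ 0) d) (Ici t) t := by
    intro t ht
    have h2 := (hφ' t (Ico_subset_Icc_self ht)).mono_of_mem_nhdsWithin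
      (Icc_mem_nhdsGE_of_mem ht)
    have h3 := ((hasDerivAt_id t).mul_const (fderivWithin ℝ φ σ (γ 0) d)).hasDerivWithinAt
      (s := Ici t)
    simp only [one_mul] at h3
    exact (h2.sub_const _).sub h3
  have hcont : ContinuousOn (fun t => φ (γ t) - φ x₀ - t * fderivWithin ℝ φ σ (γ 0) d)
      (Icc 0 1) := by
    have h2 : ContinuousOn (fun t => φ (γ t)) (Icc 0 1) := fun t ht =>
      (hφ' t ht).continuousWithinAt
    exact (h2.sub continuousOn_const).sub (continuousOn_id.mul continuousOn_const)
  have hB : ∀ t : ℝ, HasDerivAt (fun t => n * β / 2 * ‖d‖ ^ 2 * t ^ 2)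
      (n * β * ‖d‖ ^ 2 * (t - 0)) t := by
    intro t
    have h2 := ((hasDerivAt_pow 2 t).const_mul (n * β / 2 * ‖d‖ ^ 2))
    refine h2.congr_deriv ?_
    push_cast
    ring
  have h4 := image_norm_le_of_norm_deriv_right_le_deriv_boundary hcont hright
    (by simp [hγ]) hB (fun t ht => h1 t (Ico_subset_Icc_self ht)) (right_mem_Icc.2 zero_le_one)
  simpa [hγ, hd] using h4

end PartialDerivatives

/-! ### Interpolation error and Lipschitz continuity of piecewise C² functions. -/

namespace Triangulation

variable {n : ℕ} (T : Triangulation n)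

/-- The error of the linear interpolation on a simplex. -/
theorem abs_sub_sum_le {i : Fin T.card} {φ : State n → ℝ} (hφ : ContDiffOn ℝ 2 φ (T.simplex i))
    {β : ℝ} (hβ : ∀ q r, ∀ ξ ∈ T.simplex i, |partialD2 (T.simplex i) φ q r ξ| ≤ β)
    {w : Fin (n + 1) → ℝ} (h0 : ∀ j, 0 ≤ w j) (h1 : ∑ j, w j = 1)
    (hx : ∑ j, w j • T.vert i j ∈ T.simplex i) :
    |φ (∑ j, w j • T.vert i j) - ∑ j, w j * φ (T.vert i j)| ≤ ∑ j, w j * (T.c i j * β) := by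
  set x := ∑ j, w j • T.vert i j with hxdef
  set x₀ := T.vert i 0 with hx₀
  set L := fderivWithin ℝ φ (T.simplex i) x₀ with hL
  set D : ℝ := ⨆ k : Fin n, ‖T.vert i k.succ - x₀‖ with hD
  have hx₀m : x₀ ∈ T.simplex i := T.vert_mem_simplex i 0
  have htay : ∀ z ∈ T.simplex i, |φ z - φ x₀ - L (z - x₀)| ≤ n * β / 2 * ‖z - x₀‖ ^ 2 :=
    fun z hz => abs_sub_sub_fderivWithin_le (T.uniqueDiffOn_simplex i) (T.convex_simplex i) hφ hβ
      hx₀m hz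
  have hβn : 0 ≤ n * β / 2 := by
    rcases Nat.eq_zero_or_pos n with rfl | hn
    · simp
    have hβ0 : 0 ≤ β := (abs_nonneg _).trans (hβ ⟨0, hn⟩ ⟨0, hn⟩ x₀ hx₀m)
    positivity
  have hDj : ∀ j, ‖T.vert i j - x₀‖ ≤ D := by
    intro j
    refine Fin.cases ?_ (fun k => ?_) j
    · rw [sub_self, norm_zero]
      exact Real.iSup_nonneg fun _ => norm_nonneg _
    · exact le_ciSup (f := fun k : Fin n => ‖T.vert i k.succ - x₀‖) (finite_range _).bddAbove k
  have hsub : x - x₀ = ∑ j, w j • (T.vert i j - x₀) := by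
    simp only [smul_sub, Finset.sum_sub_distrib, ← Finset.sum_smul, h1, one_smul, hxdef]
  have hs : ‖x - x₀‖ ≤ ∑ j, w j * ‖T.vert i j - x₀‖ := by
    rw [hsub]
    refine (norm_sum_le _ _).trans (Finset.sum_le_sum fun j _ => ?_)
    rw [norm_smul, Real.norm_of_nonneg (h0 j)]
  have hsD : ‖x - x₀‖ ≤ D := by
    refine hs.trans ?_
    calc _ ≤ ∑ j, w j * D :=
          Finset.sum_le_sum fun j _ => mul_le_mul_of_nonneg_left (hDj j) (h0 j)
      _ = D := by rw [← Finset.sum_mul, h1, one_mul]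
  -- One factor is averaged over the vertices and the other is bounded by D; this gives the product
  -- with the maximum in c_{i,j}.
  have hsq : ‖x - x₀‖ ^ 2 ≤ ∑ j, w j * (‖T.vert i j - x₀‖ * D) := by
    have : ∑ j, w j * (‖T.vert i j - x₀‖ * D) = (∑ j, w j * ‖T.vert i j - x₀‖) * D := by
      rw [Finset.sum_mul]; exact Finset.sum_congr rfl fun j _ => by ring
    rw [this, pow_two]
    exact mul_le_mul hs hsD (norm_nonneg _) ((norm_nonneg _).trans hs)
  -- The first-order terms cancel because x - x₀ is the average of the edges. The Taylor remainders
  -- at x and at the vertices account for the two summands of c_{i,j}.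
  have heq : φ x - ∑ j, w j * φ (T.vert i j) = (φ x - φ x₀ - L (x - x₀))
      - ∑ j, w j * (φ (T.vert i j) - φ x₀ - L (T.vert i j - x₀)) := by
    have h2 : L (x - x₀) = ∑ j, w j * L (T.vert i j - x₀) := by
      rw [hsub, map_sum]; simp
    simp only [mul_sub, Finset.sum_sub_distrib, ← Finset.sum_mul, h1, h2]
    ring
  have h3 : |∑ j, w j * (φ (T.vert i j) - φ x₀ - L (T.vert i j - x₀))|
      ≤ ∑ j, w j * (n * β / 2 * ‖T.vert i j - x₀‖ ^ 2) := by
    refine (Finset.abs_sum_le_sum_abs _ _).trans (Finset.sum_le_sum fun j _ => ?_)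
    rw [abs_mul, abs_of_nonneg (h0 j)]
    exact mul_le_mul_of_nonneg_left (htay _ (T.vert_mem_simplex i j)) (h0 j)
  rw [heq]
  refine (abs_sub _ _).trans ?_
  have h4 : n * β / 2 * ‖x - x₀‖ ^ 2 ≤ n * β / 2 * ∑ j, w j * (‖T.vert i j - x₀‖ * D) :=
    mul_le_mul_of_nonneg_left hsq hβn
  have h5 : ∑ j, w j * (T.c i j * β) = n * β / 2 * ∑ j, w j * (‖T.vert i j - x₀‖ * D)
      + ∑ j, w j * (n * β / 2 * ‖T.vert i j - x₀‖ ^ 2) := by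
    rw [Finset.mul_sum, ← Finset.sum_add_distrib]
    refine Finset.sum_congr rfl fun j _ => ?_
    rw [c]; ring
  have h6 := htay x hx
  linarith

theorem PiecewiseC2.exists_lipschitzOnWith {T : Triangulation n} {φ : State n → ℝ}
    (hφ : T.PiecewiseC2 φ) : ∃ K, LipschitzOnWith K φ T.carrier := by
  refine T.exists_lipschitzOnWith_carrier hφ.1 fun i => ?_
  have hd : ContinuousOn (fderivWithin ℝ φ (T.simplex i)) (T.simplex i) :=
    (hφ.2 i).continuousOn_fderivWithin (T.uniqueDiffOn_simplex i) (by norm_num)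
  obtain ⟨C, hC⟩ := (T.isCompact_simplex i).exists_bound_of_continuousOn hd
  refine ⟨C.toNNReal, (T.convex_simplex i).lipschitzOnWith_of_nnnorm_fderivWithin_le
    ((hφ.2 i).differentiableOn (by norm_num)) fun x hx => ?_⟩
  rw [← NNReal.coe_le_coe, coe_nnnorm]
  exact (hC x hx).trans (Real.le_coe_toNNReal C)

end Triangulation

/-! ### Second derivatives of the closed loop and decrease of V on each simplex. -/

namespace ControlSystem

variable {n m p : ℕ} {S : ControlSystem n m p} {T : Triangulation n} {y : Unknowns T m}

theorem isGreatest_mu (hn : 0 < n) (hf : ∀ k, T.PiecewiseC2 (fun x => S.f x k))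
    (hG : ∀ k s, T.PiecewiseC2 (fun x => S.G x k s)) (i : Fin T.card) :
    IsGreatest (S.muSet T i) (S.mu T i) := by
  have : Nonempty (Fin n) := ⟨⟨0, hn⟩⟩
  have hu := T.uniqueDiffOn_simplex i
  refine isGreatest_sSup_iUnion_image (ι := Fin n × Fin n × Fin n) (T.isCompact_simplex i)
    ⟨_, T.vert_mem_simplex i 0⟩
    (F := fun a ξ => |partialD2 (T.simplex i) (fun x => S.f x a.1) a.2.1 a.2.2 ξ| +
      ∑ s, |partialD2 (T.simplex i) (fun x => S.G x a.1 s) a.2.1 a.2.2 ξ| * S.inputBound s) ?_ ?_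
  · intro a
    refine (continuousOn_partialD2 hu ((hf _).2 i) _ _).abs.add ?_
    exact continuousOn_finsetSum _ fun s _ =>
      (continuousOn_partialD2 hu ((hG _ s).2 i) _ _).abs.mul continuousOn_const
  · ext t
    simp only [muSet, mem_ofPred_eq, mem_iUnion, mem_image, Prod.exists]
    exact ⟨fun ⟨a, b, c, ξ, h, e⟩ => ⟨a, b, c, ξ, h, e.symm⟩,
      fun ⟨a, b, c, ξ, h, e⟩ => ⟨a, b, c, ξ, h, e.symm⟩⟩

theorem isGreatest_eta (hn : 0 < n)
    (hG : ∀ k s, T.PiecewiseC2 (fun x => S.G x k s)) (i : Fin T.card) :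
    IsGreatest (S.etaSet T i) (S.eta T i) := by
  have : Nonempty (Fin n) := ⟨⟨0, hn⟩⟩
  have hu := T.uniqueDiffOn_simplex i
  refine isGreatest_sSup_iUnion_image (ι := Fin n × Fin n × Fin n) (T.isCompact_simplex i)
    ⟨_, T.vert_mem_simplex i 0⟩
    (F := fun a ξ => ∑ s, (|partialD (T.simplex i) (fun x => S.G x a.1 s) a.2.1 ξ| +
      |partialD (T.simplex i) (fun x => S.G x a.1 s) a.2.2 ξ|)) ?_ ?_
  · intro a
    exact continuousOn_finsetSum _ fun s _ =>
      (contDiffOn_partialD hu ((hG _ s).2 i) _).continuousOn.abs.add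
        (contDiffOn_partialD hu ((hG _ s).2 i) _).continuousOn.abs
  · ext t
    simp only [etaSet, mem_ofPred_eq, mem_iUnion, mem_image, Prod.exists]
    exact ⟨fun ⟨a, b, c, ξ, h, e⟩ => ⟨a, b, c, ξ, h, e.symm⟩,
      fun ⟨a, b, c, ξ, h, e⟩ => ⟨a, b, c, ξ, h, e.symm⟩⟩

theorem closedLoop_apply (y : Unknowns T m) (x : State n) (k : Fin n) :
    S.closedLoop y x k = S.f x k + ∑ s, S.G x k s * T.interp (fun v => y.u v s) x := rfl

theorem closedLoop_eqOn (y : Unknowns T m) (i : Fin T.card) (k : Fin n) :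
    EqOn (fun x => S.closedLoop y x k)
      (fun x => S.f x k + ∑ s, S.G x k s * T.piece i (fun v => y.u v s) x) (T.simplex i) := by
  intro x hx
  simp only [closedLoop_apply, T.interp_eqOn i _ hx]

theorem piecewiseC2_closedLoop (hf : ∀ k, T.PiecewiseC2 (fun x => S.f x k))
    (hG : ∀ k s, T.PiecewiseC2 (fun x => S.G x k s)) (y : Unknowns T m) (k : Fin n) :
    T.PiecewiseC2 (fun x => S.closedLoop y x k) := by
  refine ⟨?_, fun i => ?_⟩
  · simp only [closedLoop_apply]
    exact (hf k).1.add (continuousOn_finsetSum _ fun s _ =>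
      (hG k s).1.mul (T.continuousOn_interp _))
  · refine ContDiffOn.congr ?_ (closedLoop_eqOn y i k)
    exact ((hf k).2 i).add (ContDiffOn.sum fun s _ =>
      ((hG k s).2 i).mul (T.contDiff_piece i _).contDiffOn)

theorem partialD_piece (i : Fin T.card) (W : T.vertices → ℝ) (q : Fin n) {ξ : State n}
    (hξ : ξ ∈ T.simplex i) : partialD (T.simplex i) (T.piece i W) q ξ = T.grad i W q := by
  rw [partialD, ((T.hasFDerivAt_piece i W ξ).hasFDerivWithinAt).fderivWithin
    (T.uniqueDiffOn_simplex i ξ hξ), T.gradCLM_apply]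
  simp

/-- The product rule applied twice; no second derivative of u appears, as u is affine on the
simplex. -/
theorem partialD2_closedLoop (hf : ∀ k, T.PiecewiseC2 (fun x => S.f x k))
    (hG : ∀ k s, T.PiecewiseC2 (fun x => S.G x k s)) (y : Unknowns T m) (i : Fin T.card)
    (k q r : Fin n) {ξ : State n} (hξ : ξ ∈ T.simplex i) :
    partialD2 (T.simplex i) (fun x => S.closedLoop y x k) q r ξ =
      partialD2 (T.simplex i) (fun x => S.f x k) q r ξ +
      ∑ s, (partialD2 (T.simplex i) (fun x => S.G x k s) q r ξ * y.ctrl ξ s +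
        partialD (T.simplex i) (fun x => S.G x k s) r ξ * T.grad i (fun v => y.u v s) q +
        partialD (T.simplex i) (fun x => S.G x k s) q ξ * T.grad i (fun v => y.u v s) r) := by
  have hu := T.uniqueDiffOn_simplex i
  have hfd := ((hf k).2 i).differentiableOn (n := 2) (by norm_num)
  have hGd := fun s => ((hG k s).2 i).differentiableOn (n := 2) (by norm_num)
  have hfd1 := (contDiffOn_partialD hu ((hf k).2 i) r).differentiableOn (n := 1) (by norm_num)
  have hGd1 := fun s =>
    (contDiffOn_partialD hu ((hG k s).2 i) r).differentiableOn (n := 1) (by norm_num)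
  have hP : ∀ s x, DifferentiableWithinAt ℝ (T.piece i fun v => y.u v s) (T.simplex i) x :=
    fun s x => (T.hasFDerivAt_piece i _ x).differentiableAt.differentiableWithinAt
  have h1 : EqOn (partialD (T.simplex i) (fun x => S.closedLoop y x k) r)
      (fun x => partialD (T.simplex i) (fun x => S.f x k) r x +
        ∑ s, (partialD (T.simplex i) (fun x => S.G x k s) r x * T.piece i (fun v => y.u v s) x +
          S.G x k s * T.grad i (fun v => y.u v s) r)) (T.simplex i) := by
    intro x hx
    rw [partialD_congr (closedLoop_eqOn y i k) r hx, partialD_add hu hx (hfd x hx)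
      (DifferentiableWithinAt.fun_sum fun s _ => (hGd s x hx).fun_mul (hP s x)),
      partialD_sum _ hu hx fun s _ => (hGd s x hx).fun_mul (hP s x)]
    congr 1
    refine Finset.sum_congr rfl fun s _ => ?_
    rw [partialD_mul hu hx (hGd s x hx) (hP s x), partialD_piece i _ r hx]
  rw [partialD2, partialD_congr h1 q hξ]
  have hA : ∀ s, DifferentiableWithinAt ℝ (fun x =>
      partialD (T.simplex i) (fun x => S.G x k s) r x * T.piece i (fun v => y.u v s) x)
      (T.simplex i) ξ := fun s => (hGd1 s ξ hξ).fun_mul (hP s ξ)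
  have hB : ∀ s, DifferentiableWithinAt ℝ (fun x => S.G x k s * T.grad i (fun v => y.u v s) r)
      (T.simplex i) ξ := fun s => (hGd s ξ hξ).mul_const _
  rw [partialD_add hu hξ (hfd1 ξ hξ)
      (DifferentiableWithinAt.fun_sum fun s _ => (hA s).fun_add (hB s)),
    partialD_sum _ hu hξ fun s _ => (hA s).fun_add (hB s)]
  congr 1
  refine Finset.sum_congr rfl fun s _ => ?_
  rw [partialD_add hu hξ (hA s) (hB s), partialD_mul hu hξ (hGd1 s ξ hξ) (hP s ξ),
    partialD_mul_const hu hξ (hGd s ξ hξ), partialD_piece i _ q hξ,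
    ← T.interp_eqOn i _ hξ]
  rfl

theorem Feasible.abs_partialD2_closedLoop_le (hy : S.Feasible y)
    (hU : S.inputs ∈ regularSets (Fin m → ℝ))
    (hf : ∀ k, T.PiecewiseC2 (fun x => S.f x k))
    (hG : ∀ k s, T.PiecewiseC2 (fun x => S.G x k s)) (i : Fin T.card) (k q r : Fin n)
    {ξ : State n} (hξ : ξ ∈ T.simplex i) :
    |partialD2 (T.simplex i) (fun x => S.closedLoop y x k) q r ξ|
      ≤ S.mu T i + S.eta T i * y.z i := by
  have hn : 0 < n := k.pos
  have hmu := (isGreatest_mu hn hf hG i).2 ⟨k, q, r, ξ, hξ, rfl⟩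
  have heta := (isGreatest_eta hn hG i).2 ⟨k, q, r, ξ, hξ, rfl⟩
  have hctrl : ∀ s, |y.ctrl ξ s| ≤ S.inputBound s := fun s =>
    (S.isGreatest_inputBound hU s).2
      ⟨_, hy.ctrl_mem hU (T.simplex_subset_carrier i hξ), rfl⟩
  have hetaz : (∑ s, (|partialD (T.simplex i) (fun x => S.G x k s) q ξ| +
      |partialD (T.simplex i) (fun x => S.G x k s) r ξ|)) * y.z i ≤ S.eta T i * y.z i := by
    -- Without inputs no constraint forces z ≥ 0, but then η = 0.
    rcases Nat.eq_zero_or_pos m with rfl | hm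
    · have h0 : S.eta T i = 0 := by
        obtain ⟨_, _, _, _, _, h⟩ := (isGreatest_eta hn hG i).1
        rw [h]; simp
      simp [h0]
    · exact mul_le_mul_of_nonneg_right heta ((abs_nonneg _).trans (hy.grad_u i ⟨0, hm⟩ k))
  rw [partialD2_closedLoop hf hG y i k q r hξ]
  refine (abs_add_le _ _).trans ?_
  have hsum : |∑ s, (partialD2 (T.simplex i) (fun x => S.G x k s) q r ξ * y.ctrl ξ s +
        partialD (T.simplex i) (fun x => S.G x k s) r ξ * T.grad i (fun v => y.u v s) q +
        partialD (T.simplex i) (fun x => S.G x k s) q ξ * T.grad i (fun v => y.u v s) r)| ≤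
      ∑ s, |partialD2 (T.simplex i) (fun x => S.G x k s) q r ξ| * S.inputBound s +
      (∑ s, (|partialD (T.simplex i) (fun x => S.G x k s) q ξ| +
      |partialD (T.simplex i) (fun x => S.G x k s) r ξ|)) * y.z i := by
    rw [Finset.sum_mul, ← Finset.sum_add_distrib]
    refine (Finset.abs_sum_le_sum_abs _ _).trans (Finset.sum_le_sum fun s _ => ?_)
    refine (abs_add_three _ _ _).trans ?_
    rw [abs_mul, abs_mul, abs_mul]
    have h1 := mul_le_mul_of_nonneg_left (hctrl s)
      (abs_nonneg (partialD2 (T.simplex i) (fun x => S.G x k s) q r ξ))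
    have h2 := mul_le_mul_of_nonneg_left (hy.grad_u i s q)
      (abs_nonneg (partialD (T.simplex i) (fun x => S.G x k s) r ξ))
    have h3 := mul_le_mul_of_nonneg_left (hy.grad_u i s r)
      (abs_nonneg (partialD (T.simplex i) (fun x => S.G x k s) q ξ))
    linarith
  linarith

/-- The vertex constraints force the decrease of the Lyapunov function along the closed loop on
the whole simplex. -/
theorem Feasible.gradCLM_closedLoop_le (hy : S.Feasible y)
    (hU : S.inputs ∈ regularSets (Fin m → ℝ))
    (hf : ∀ k, T.PiecewiseC2 (fun x => S.f x k))
    (hG : ∀ k s, T.PiecewiseC2 (fun x => S.G x k s)) {i : Fin T.card}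
    {x : State n} (hx : x ∈ T.simplex i) :
    T.gradCLM i y.V (S.closedLoop y x) ≤ -y.b₂ * y.lyap x := by
  obtain ⟨w, h0, h1, h2, h3⟩ := T.exists_interp_eq_sum hx
  set β := S.mu T i + S.eta T i * y.z i with hβ
  -- The deviation of g from its interpolation, paired with the gradient, is paid for by the l-term
  -- of D⁺.
  have herr : ∀ k, T.grad i y.V k * (S.closedLoop y x k
      - ∑ j, w j * S.closedLoop y (T.vert i j) k) ≤ y.l i k * ∑ j, w j * (T.c i j * β) := by
    intro k
    have h4 := T.abs_sub_sum_le ((piecewiseC2_closedLoop hf hG y k).2 i)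
      (fun q r ξ hξ => hy.abs_partialD2_closedLoop_le hU hf hG i k q r hξ) h0 h1
      (by rw [h2]; exact hx)
    rw [h2] at h4
    refine (le_abs_self _).trans ?_
    rw [abs_mul]
    exact mul_le_mul (hy.grad_V i k) h4 (abs_nonneg _) ((abs_nonneg _).trans (hy.grad_V i k))
  have hsum := Finset.sum_le_sum fun k (_ : k ∈ Finset.univ) => herr k
  have hd : ∑ j, w j * S.dplus y i j ≤ -y.b₂ * y.lyap x := by
    rw [Unknowns.lyap, h3, Finset.mul_sum]
    refine Finset.sum_le_sum fun j _ => ?_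
    have := mul_le_mul_of_nonneg_left (hy.decrease i j) (h0 j)
    linarith
  refine le_trans ?_ hd
  have hE : ∑ j, w j * S.dplus y i j = ∑ k, T.grad i y.V k *
      ∑ j, w j * S.closedLoop y (T.vert i j) k + ∑ k, y.l i k * ∑ j, w j * (T.c i j * β) := by
    simp only [dplus_eq, mul_add, Finset.sum_add_distrib, dotProduct, Finset.mul_sum]
    congr 1
    · rw [Finset.sum_comm]
      exact Finset.sum_congr rfl fun k _ => Finset.sum_congr rfl fun j _ => by ring
    · rw [Finset.sum_comm]
      exact Finset.sum_congr rfl fun k _ => Finset.sum_congr rfl fun j _ => by rw [hβ]; ring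
  rw [hE, T.gradCLM_apply, dotProduct]
  simp only [mul_sub, Finset.sum_sub_distrib] at hsum
  linarith

end ControlSystem

end CPA

/-! ### Global forward solutions, trapping, and extension of vector fields. -/

/-- A bounded Lipschitz vector field has forward solutions for all times. -/
theorem exists_forward_solution {E : Type*} [NormedAddCommGroup E] [NormedSpace ℝ E]
    [CompleteSpace E] {v : E → E} {K : NNReal}
    (hv : LipschitzWith K v) {M : NNReal} (hM : ∀ x, ‖v x‖ ≤ M) (t₀ : ℝ) (x₀ : E) :
    ∃ x : ℝ → E, x t₀ = x₀ ∧ ∀ t ∈ Ici t₀, HasDerivWithinAt x (v (x t)) (Ici t₀) t := by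
  have hloc : ∀ N : ℕ, ∃ x : ℝ → E, x t₀ = x₀ ∧
      ∀ t ∈ Icc t₀ (t₀ + N), HasDerivWithinAt x (v (x t)) (Icc t₀ (t₀ + N)) t := by
    intro N
    have hN : (0 : ℝ) ≤ N := N.cast_nonneg
    -- A curve of speed at most M travels at most M N in time N, so the ball of radius M N serves
    -- the whole interval.
    have hpl : IsPicardLindelof (fun _ => v)
        (⟨t₀, le_rfl, by linarith⟩ : Icc t₀ (t₀ + N)) x₀ (M * N) 0 M K :=
      { lipschitzOnWith := fun _ _ => hv.lipschitzOnWith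
        continuousOn := fun _ _ => continuousOn_const
        norm_le := fun _ _ x _ => hM x
        mul_max_le := by simp }
    exact hpl.exists_eq_forall_mem_Icc_hasDerivWithinAt₀
  choose X hX0 hX using hloc
  have huniq : ∀ N N' : ℕ, ∀ t ∈ Icc t₀ (t₀ + N), t ≤ t₀ + N' → X N t = X N' t := by
    intro N N' t ht ht'
    have key : ∀ L : ℕ, t ≤ t₀ + L → ContinuousOn (X L) (Icc t₀ t) ∧
        ∀ s ∈ Ico t₀ t, HasDerivWithinAt (X L) (v (X L s)) (Ici s) s := by
      intro L hL
      refine ⟨fun s hs => ?_, fun s hs => ?_⟩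
      · exact ((hX L s ⟨hs.1, hs.2.trans hL⟩).continuousWithinAt).mono (Icc_subset_Icc_right hL)
      · exact (hX L s ⟨hs.1, hs.2.le.trans hL⟩).mono_of_mem_nhdsWithin
          (Icc_mem_nhdsGE_of_mem ⟨hs.1, hs.2.trans_le hL⟩)
    exact ODE_solution_unique (v := fun _ => v) (fun _ => hv) (key N ht.2).1 (key N ht.2).2
      (key N' ht').1 (key N' ht').2 ((hX0 N).trans (hX0 N').symm) ⟨ht.1, le_rfl⟩
  have hceil : ∀ t, t ≤ t₀ + (⌈t - t₀⌉₊ : ℕ) := fun t => by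
    have := Nat.le_ceil (t - t₀); linarith
  refine ⟨fun t => X ⌈t - t₀⌉₊ t, hX0 _, fun t ht => ?_⟩
  -- The extra 1 puts t strictly before the right end, so the derivative within the interval is one
  -- within `Ici t₀`.
  set N : ℕ := ⌈t - t₀⌉₊ + 1 with hN
  have htN : t < t₀ + N := by
    have := hceil t
    rw [hN]; push_cast; linarith
  have heq : ∀ s ∈ Icc t₀ (t₀ + N), X ⌈s - t₀⌉₊ s = X N s := fun s hs =>
    (huniq N _ s hs (hceil s)).symm
  have h1 := hX N t ⟨ht, htN.le⟩
  have h2 := h1.congr_of_mem heq ⟨ht, htN.le⟩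
  rw [← heq t ⟨ht, htN.le⟩] at h2
  refine h2.mono_of_mem_nhdsWithin ?_
  rw [← Ici_inter_Iic]
  exact inter_mem_nhdsWithin _ (Iic_mem_nhds htN)

/-- A curve which stays in an open set `O` as long as it stays in its closed superset `C` never
leaves `O`. -/
theorem forall_mem_of_trapped {E : Type*} [TopologicalSpace E] {O C : Set E} (hO : IsOpen O)
    (hC : IsClosed C) (hOC : O ⊆ C) {x : ℝ → E} {t₀ : ℝ} (hx : ContinuousOn x (Ici t₀)) (h0 : x t₀ ∈ O)
    (h : ∀ t₁ ≥ t₀, (∀ t ∈ Icc t₀ t₁, x t ∈ C) → x t₁ ∈ O) : ∀ t ∈ Ici t₀, x t ∈ O := by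
  by_contra! hcon
  obtain ⟨s, hs, hsO⟩ := hcon
  set B := Ici t₀ ∩ x ⁻¹' Oᶜ with hB
  have hBcl : IsClosed B := hx.preimage_isClosed_of_isClosed isClosed_Ici hO.isClosed_compl
  have hbdd : BddBelow B := ⟨t₀, fun t ht => ht.1⟩
  have hmem := hBcl.csInf_mem ⟨s, hs, hsO⟩ hbdd
  -- τ would be the first time outside O. Before τ the curve is in O, so at τ it is in the closed
  -- set C by continuity, and the hypothesis puts it back into O.
  set τ := sInf B with hτ
  have hlt : ∀ t ∈ Ico t₀ τ, x t ∈ O := by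
    intro t ht
    by_contra hcon
    exact absurd (csInf_le hbdd ⟨ht.1, hcon⟩) (not_le.2 ht.2)
  refine hmem.2 (h τ hmem.1 fun t ht => ?_)
  rcases ht.2.eq_or_lt with rfl | htτ
  · rcases (mem_Ici.1 hmem.1).eq_or_lt with he | hlt'
    · exact absurd (he ▸ h0) hmem.2
    · have h1 : ContinuousWithinAt x (Ico t₀ τ) τ := (hx τ hmem.1).mono fun t ht => ht.1
      have h2 : τ ∈ closure (Ico t₀ τ) := by
        rw [closure_Ico hlt'.ne]
        exact right_mem_Icc.2 hlt'.le
      have h3 := h1.mem_closure_image h2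
      refine hC.closure_subset_iff.2 ?_ h3
      rintro _ ⟨t, ht, rfl⟩
      exact hOC (hlt t ht)
  · exact hOC (hlt t ⟨ht.1, htτ⟩)

namespace CPA

/-- A vector field with Lipschitz components on a compact set extends to a bounded Lipschitz vector
field. -/
theorem exists_bounded_lipschitz_extension {n : ℕ} {g : State n → State n} {Ω : Set (State n)}
    (hΩ : IsCompact Ω) (hg : ∀ k, ∃ K, LipschitzOnWith K (fun x => g x k) Ω) :
    ∃ (v : State n → State n) (K M : NNReal), LipschitzWith K v ∧ (∀ x, ‖v x‖ ≤ M) ∧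
      EqOn v g Ω := by
  choose K hK using hg
  choose e he heq using fun k => (hK k).extend_real
  have hb : ∀ k, ∃ C : ℝ, ∀ x ∈ Ω, ‖g x k‖ ≤ C := fun k =>
    hΩ.exists_bound_of_continuousOn (hK k).continuousOn
  choose C hC using hb
  -- Truncating the extended components at ±C makes the field bounded, keeps it Lipschitz and
  -- changes nothing on Ω.
  have hpi : LipschitzWith (∑ k, K k) fun (x : State n) (k : Fin n) =>
      max (-C k) (min (C k) (e k x)) := by
    refine LipschitzWith.of_dist_le_mul fun x z => ?_
    refine (dist_pi_le_iff (by positivity)).2 fun k => ?_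
    refine ((((he k).const_min (C k)).const_max (-C k)).dist_le_mul x z).trans
      (mul_le_mul_of_nonneg_right ?_ dist_nonneg)
    exact_mod_cast Finset.single_le_sum (f := K) (fun _ _ => zero_le) (Finset.mem_univ k)
  have hlip := (PiLp.lipschitzWith_toLp 2 fun _ : Fin n => ℝ).comp hpi
  obtain ⟨M, hM⟩ := (isCompact_Icc (a := fun k => min (-C k) (C k))
    (b := fun k => max (-C k) (C k))).exists_bound_of_continuousOn
    (PiLp.lipschitzWith_toLp 2 fun _ : Fin n => ℝ).continuous.continuousOn
  refine ⟨_, _, M.toNNReal, hlip, fun x => (hM _ ⟨fun k => ?_, fun k => ?_⟩).trans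
    (Real.le_coe_toNNReal M), fun x hx => ?_⟩
  · exact (min_le_left _ _).trans (le_max_left _ _)
  · exact max_le_max le_rfl (min_le_left _ _)
  · ext k
    have h1 := hC k x hx
    rw [Real.norm_eq_abs, abs_le] at h1
    simp only [Function.comp_apply]
    rw [← heq k hx, min_eq_right h1.2, max_eq_right h1.1]

/-! ### Exponential decay, stability and invariance of sublevel sets. -/

namespace ControlSystem

variable {n m p : ℕ} {S : ControlSystem n m p} {T : Triangulation n} {y : Unknowns T m}

/-- Along solutions in the triangulation the Lyapunov function decays exponentially. -/
theorem Feasible.lyap_le_mul_exp (hy : S.Feasible y)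
    (hU : S.inputs ∈ regularSets (Fin m → ℝ))
    (hf : ∀ k, T.PiecewiseC2 (fun x => S.f x k))
    (hG : ∀ k s, T.PiecewiseC2 (fun x => S.G x k s)) {t₀ t₁ : ℝ} {x : ℝ → State n}
    (hx : IsSolution (S.closedLoop y) T.carrier (Icc t₀ t₁) x) {t : ℝ} (ht : t ∈ Icc t₀ t₁) :
    y.lyap (x t) ≤ y.lyap (x t₀) * Real.exp (-y.b₂ * (t - t₀)) := by
  have hxc : ContinuousOn x (Icc t₀ t₁) := fun t ht => (hx t ht).2.continuousWithinAt
  have hcont : ContinuousOn (fun t => y.lyap (x t)) (Icc t₀ t₁) :=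
    (T.continuousOn_interp y.V).comp hxc fun t ht => (hx t ht).1
  have h := le_gronwallBound_of_liminf_deriv_right_le (f' := fun t => -y.b₂ * y.lyap (x t))
    (K := -y.b₂) (ε := 0) hcont ?_ le_rfl (fun t _ => by simp) t ht
  · rwa [gronwallBound_ε0] at h
  intro t ht r hr
  have htI := Ico_subset_Icc_self ht
  refine Eventually.frequently ?_
  have hIcc : Icc t₀ t₁ ∈ 𝓝[>] t := Icc_mem_nhdsGT_of_mem ht
  have hder : HasDerivWithinAt x (S.closedLoop y (x t)) (Ioi t) t :=
    (hx t htI).2.mono_of_mem_nhdsWithin hIcc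
  have hslope := (hasDerivWithinAt_iff_tendsto_slope' (lt_irrefl t)).1 hder
  have hxt : Tendsto x (𝓝[>] t) (𝓝 (x t)) := hder.continuousWithinAt
  -- The slopes are taken along the trajectory itself: at a boundary point x + h g(x) may leave the
  -- triangulation. The gradient bound holds in every simplex at x t, so it does not matter which
  -- one the trajectory enters.
  have hi : ∀ i, x t ∈ T.simplex i →
      ∀ᶠ z in 𝓝[>] t, T.gradCLM i y.V (slope x t z) < r := by
    intro i hi
    have h1 := ((T.gradCLM i y.V).continuous.tendsto _).comp hslope
    exact h1.eventually (gt_mem_nhds ((hy.gradCLM_closedLoop_le hU hf hG hi).trans_lt hr))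
  have hall : ∀ᶠ z in 𝓝[>] t, ∀ i, x t ∈ T.simplex i →
      T.gradCLM i y.V (slope x t z) < r := by
    refine eventually_all.2 fun i => ?_
    by_cases h : x t ∈ T.simplex i
    · exact (hi i h).mono fun _ hz _ => hz
    · exact Eventually.of_forall fun _ h' => absurd h' h
  filter_upwards [hIcc, hxt.eventually (T.eventually_mem_simplex (x t)), hall] with z hz hzs hzr
  obtain ⟨i, hzi⟩ := mem_iUnion.1 (hx z hz).1
  have hti := hzs i hzi
  have := hzr i hti
  rw [slope_def_module, map_smul, ← T.piece_sub_piece, smul_eq_mul] at this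
  rwa [Unknowns.lyap, T.interp_eqOn i _ hzi, T.interp_eqOn i _ hti]

/-- At an interior point a short step along g stays in a simplex containing x, where the difference
quotient of V is exactly the gradient applied to g(x). -/
theorem Feasible.dini_le (hy : S.Feasible y)
    (hU : S.inputs ∈ regularSets (Fin m → ℝ))
    (hf : ∀ k, T.PiecewiseC2 (fun x => S.f x k))
    (hG : ∀ k s, T.PiecewiseC2 (fun x => S.G x k s)) {x : State n} (hx : x ∈ interior T.carrier) :
    dini (S.closedLoop y) y.lyap x ≤ ((-y.b₂ * y.lyap x : ℝ) : EReal) := by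
  have hcont : Tendsto (fun h : ℝ => x + h • S.closedLoop y x) (𝓝[>] 0) (𝓝 x) := by
    have h1 : Continuous fun h : ℝ => x + h • S.closedLoop y x := by fun_prop
    have h2 := h1.tendsto 0
    rw [zero_smul, add_zero] at h2
    exact h2.mono_left nhdsWithin_le_nhds
  refine limsup_le_of_le (by isBoundedDefault) ?_
  filter_upwards [hcont.eventually (T.eventually_mem_simplex x),
    hcont.eventually (mem_interior_iff_mem_nhds.1 hx), self_mem_nhdsWithin] with h hs hc hpos
  obtain ⟨i, hi⟩ := mem_iUnion.1 hc
  rw [EReal.coe_le_coe_iff, Unknowns.lyap, T.interp_eqOn i _ hi, T.interp_eqOn i _ (hs i hi),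
    T.piece_sub_piece, add_sub_cancel_left, map_smul, smul_eq_mul,
    mul_div_cancel_left₀ _ (ne_of_gt hpos), ← T.interp_eqOn i _ (hs i hi)]
  exact hy.gradCLM_closedLoop_le hU hf hG (hs i hi)

theorem Feasible.isLyapunov (hy : S.Feasible y)
    (hU : S.inputs ∈ regularSets (Fin m → ℝ))
    (hf : ∀ k, T.PiecewiseC2 (fun x => S.f x k))
    (hG : ∀ k s, T.PiecewiseC2 (fun x => S.G x k s)) (hb₂ : 0 < y.b₂) {a b : ℝ} (ha : 0 < a)
    (hb : 0 < b) (hlow : ∀ x ∈ T.carrier, b * ‖x‖ ^ a ≤ y.lyap x) :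
    IsLyapunov (S.closedLoop y) T.carrier y.lyap a b y.b₂ where
  a_pos := ha
  b₁_pos := hb
  b₂_pos := hb₂
  lipschitz := T.exists_lipschitzOnWith_interp y.V
  zero := hy.lyap_zero
  lower := hlow
  decrease _ hx _ := hy.dini_le hU hf hG hx

/-- The closed loop extends to a vector field with forward solutions for all times. -/
theorem exists_forward_solution_extension (hf : ∀ k, T.PiecewiseC2 (fun x => S.f x k))
    (hG : ∀ k s, T.PiecewiseC2 (fun x => S.G x k s)) (y : Unknowns T m) :
    ∃ v : State n → State n, EqOn v (S.closedLoop y) T.carrier ∧ ∀ (t₀ : ℝ) (x₀ : State n),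
      ∃ x : ℝ → State n, x t₀ = x₀ ∧
        ∀ t ∈ Ici t₀, HasDerivWithinAt x (v (x t)) (Ici t₀) t := by
  obtain ⟨v, K, M, hK, hM, heq⟩ := exists_bounded_lipschitz_extension T.isCompact_carrier
    fun k => (piecewiseC2_closedLoop hf hG y k).exists_lipschitzOnWith
  exact ⟨v, heq, exists_forward_solution hK hM⟩

/-- A forward solution exists in an open set `O` when solutions that stay in a closed superset
`C` of `O` end in `O`. -/
theorem exists_solution_of_trapped (hf : ∀ k, T.PiecewiseC2 (fun x => S.f x k))
    (hG : ∀ k s, T.PiecewiseC2 (fun x => S.G x k s)) (y : Unknowns T m) {O C : Set (State n)}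
    (hO : IsOpen O) (hC : IsClosed C) (hOC : O ⊆ C) (hCT : C ⊆ T.carrier) {t₀ : ℝ} {x₀ : State n}
    (hx₀ : x₀ ∈ O)
    (h : ∀ t₁ ≥ t₀, ∀ x : ℝ → State n, x t₀ = x₀ →
      IsSolution (S.closedLoop y) T.carrier (Icc t₀ t₁) x → (∀ t ∈ Icc t₀ t₁, x t ∈ C) →
      x t₁ ∈ O) :
    ∃ x : ℝ → State n, x t₀ = x₀ ∧ IsSolution (S.closedLoop y) O (Ici t₀) x := by
  obtain ⟨v, hv, hex⟩ := exists_forward_solution_extension hf hG y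
  obtain ⟨x, hx0, hx⟩ := hex t₀ x₀
  have hO' : ∀ t ∈ Ici t₀, x t ∈ O := by
    refine forall_mem_of_trapped hO hC hOC (fun t ht => (hx t ht).continuousWithinAt)
      (hx0 ▸ hx₀) fun t₁ ht₁ hxC => h t₁ ht₁ x hx0 (fun t ht => ?_) hxC
    have hc := hCT (hxC t ht)
    refine ⟨hc, ?_⟩
    rw [← hv hc]
    exact (hx t ht.1).mono fun s hs => hs.1
  refine ⟨x, hx0, fun t ht => ⟨hO' t ht, ?_⟩⟩
  rw [← hv (hCT (hOC (hO' t ht)))]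
  exact hx t ht

theorem Feasible.isLocallyExpStable (hy : S.Feasible y)
    (hU : S.inputs ∈ regularSets (Fin m → ℝ)) (hf0 : S.f 0 = 0)
    (hf : ∀ k, T.PiecewiseC2 (fun x => S.f x k))
    (hG : ∀ k s, T.PiecewiseC2 (fun x => S.G x k s)) (hb₂ : 0 < y.b₂) :
    IsLocallyExpStable (S.closedLoop y) T.carrier := by
  obtain ⟨b, hb, hlow⟩ := hy.exists_mul_norm_le_lyap
  obtain ⟨K, hK⟩ := T.exists_lipschitzOnWith_interp y.V
  have hup : ∀ x ∈ T.carrier, y.lyap x ≤ (K + 1) * ‖x‖ := by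
    intro x hx
    have h1 := hK.dist_le_mul x hx 0 T.zero_mem_carrier
    have h2 : T.interp y.V 0 = 0 := hy.lyap_zero
    rw [h2, dist_zero_right, dist_zero_right] at h1
    have h3 := (le_abs_self _).trans h1
    have h4 : y.lyap x ≤ K * ‖x‖ := h3
    have := norm_nonneg x
    linarith
  -- The ratio of the linear upper and lower bounds of V; K + 1 instead of K keeps it positive.
  set k : ℝ := (K + 1) / b with hk
  have hkpos : 0 < k := by positivity
  have hest : ∀ (t₀ t₁ : ℝ) (x : ℝ → State n),
      IsSolution (S.closedLoop y) T.carrier (Icc t₀ t₁) x → ∀ t ∈ Icc t₀ t₁,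
      ‖x t‖ ≤ k * ‖x t₀‖ * Real.exp (-y.b₂ * (t - t₀)) := by
    intro t₀ t₁ x hx t ht
    have h1 := hy.lyap_le_mul_exp hU hf hG hx ht
    have h2 := hlow _ (hx t ht).1
    have h3 := mul_le_mul_of_nonneg_right
      (hup _ (hx t₀ (left_mem_Icc.2 (ht.1.trans ht.2))).1) (Real.exp_nonneg (-y.b₂ * (t - t₀)))
    have h4 : b * ‖x t‖ ≤ (K + 1) * ‖x t₀‖ * Real.exp (-y.b₂ * (t - t₀)) := by linarith
    rw [hk, div_mul_eq_mul_div, div_mul_eq_mul_div, le_div_iff₀ hb, mul_comm]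
    exact h4
  obtain ⟨ρ, hρ, hball⟩ := Metric.nhds_basis_closedBall.mem_iff.1
    (mem_interior_iff_mem_nhds.1 T.zero_mem_interior_carrier)
  -- Below ρ / k the decay estimate keeps solutions strictly inside the ball of radius ρ, which is
  -- the trapping needed for existence.
  refine ⟨hy.closedLoop_zero hf0, min ρ (ρ / k), lt_min hρ (by positivity), k, hkpos, y.b₂, hb₂,
    fun t₀ x₀ hx₀ => ⟨?_, ?_⟩⟩
  · obtain ⟨x, hx0, hx⟩ := exists_solution_of_trapped hf hG y Metric.isOpen_ball
      Metric.isClosed_closedBall Metric.ball_subset_closedBall hball (t₀ := t₀) (x₀ := x₀)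
      (mem_ball_zero_iff.2 (hx₀.trans_le (min_le_left _ _))) (by
        intro t₁ ht₁ x hx0 hx _
        have h1 := hest t₀ t₁ x hx t₁ (right_mem_Icc.2 ht₁)
        have h2 : ‖x t₀‖ < ρ / k := by rw [hx0]; exact hx₀.trans_le (min_le_right _ _)
        rw [lt_div_iff₀ hkpos] at h2
        have h3 : Real.exp (-y.b₂ * (t₁ - t₀)) ≤ 1 := Real.exp_le_one_iff.2
          (mul_nonpos_of_nonpos_of_nonneg (by linarith) (by linarith))
        have h4 := mul_le_mul_of_nonneg_left h3 (by positivity : 0 ≤ k * ‖x t₀‖)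
        rw [mem_ball_zero_iff]
        linarith)
    exact ⟨x, hx0, fun t ht =>
      ⟨hball (Metric.ball_subset_closedBall (hx t ht).1), (hx t ht).2⟩⟩
  · intro t₁ x hx0 hx t ht
    have := hest t₀ t₁ x hx t ht
    rwa [hx0] at this

theorem Feasible.lyap_nonneg (hy : S.Feasible y) {x : State n} (hx : x ∈ T.carrier) :
    0 ≤ y.lyap x := by
  obtain ⟨b, hb, hlow⟩ := hy.exists_mul_norm_le_lyap
  exact (by positivity : 0 ≤ b * ‖x‖).trans (hlow x hx)

theorem Feasible.norm_le_of_mem_sublevel (hy : S.Feasible y)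
    (hU : S.inputs ∈ regularSets (Fin m → ℝ))
    (hf : ∀ k, T.PiecewiseC2 (fun x => S.f x k))
    (hG : ∀ k s, T.PiecewiseC2 (fun x => S.G x k s)) (ha : 1 ≤ y.a) {r t₀ t₁ : ℝ}
    {x : ℝ → State n} (hx₀ : x t₀ ∈ y.sublevel r)
    (hx : IsSolution (S.closedLoop y) T.carrier (Icc t₀ t₁) x) {t : ℝ} (ht : t ∈ Icc t₀ t₁) :
    ‖x t‖ ≤ (r / y.b₁) ^ (1 / y.a) * Real.exp (-(y.b₂ / y.a) * (t - t₀)) := by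
  have ha0 := hy.a_pos
  have hb := hy.b₁_pos
  have hr : 0 ≤ r := hx₀.2.1.trans hx₀.2.2
  have h1 := hy.lyap_le_mul_exp hU hf hG hx ht
  have h2 := hy.rpow_le_lyap ha (hx t ht).1
  have h3 := mul_le_mul_of_nonneg_right hx₀.2.2 (Real.exp_nonneg (-y.b₂ * (t - t₀)))
  have h4 : ‖x t‖ ^ y.a ≤ r / y.b₁ * Real.exp (-y.b₂ * (t - t₀)) := by
    rw [div_mul_eq_mul_div, le_div_iff₀ hb, mul_comm]
    linarith
  have h5 := Real.rpow_le_rpow (by positivity) h4 (by positivity : 0 ≤ 1 / y.a)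
  rw [← Real.rpow_mul (norm_nonneg _), mul_one_div_cancel ha0.ne', Real.rpow_one,
    Real.mul_rpow (by positivity) (Real.exp_nonneg _), ← Real.exp_mul] at h5
  refine h5.trans_eq ?_
  congr 2
  ring

/-- After t₀ decay makes V < r strictly. Since V ≥ r on the frontier, the point is then interior to
the triangulation, and continuity of V gives a neighbourhood in the sublevel set. The time t₀ is
separate because V may equal r there. -/
theorem Feasible.mem_interior_sublevel (hy : S.Feasible y)
    (hU : S.inputs ∈ regularSets (Fin m → ℝ))
    (hf : ∀ k, T.PiecewiseC2 (fun x => S.f x k))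
    (hG : ∀ k s, T.PiecewiseC2 (fun x => S.G x k s)) (hb₂ : 0 < y.b₂) {r : ℝ} (hr : 0 < r)
    (hfr : ∀ v ∈ frontier T.carrier, r ≤ y.lyap v) {t₀ t₁ : ℝ}
    {x : ℝ → State n} (hx₀ : x t₀ ∈ interior (y.sublevel r))
    (hx : IsSolution (S.closedLoop y) T.carrier (Icc t₀ t₁) x) {t : ℝ} (ht : t ∈ Icc t₀ t₁) :
    x t ∈ interior (y.sublevel r) := by
  rcases ht.1.eq_or_lt with rfl | hlt
  · exact hx₀
  have h1 := hy.lyap_le_mul_exp hU hf hG hx ht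
  have h2 : y.lyap (x t₀) ≤ r := (interior_subset hx₀).2.2
  have h3 : Real.exp (-y.b₂ * (t - t₀)) < 1 := Real.exp_lt_one_iff.2
    (mul_neg_of_neg_of_pos (by linarith) (by linarith))
  have h4 : y.lyap (x t) < r := by
    have h5 := mul_le_mul_of_nonneg_right h2 (Real.exp_nonneg (-y.b₂ * (t - t₀)))
    have h6 := mul_lt_mul_of_pos_left h3 hr
    linarith
  have hxt := (hx t ht).1
  have hint : x t ∈ interior T.carrier := by
    by_contra hcon
    exact absurd (hfr _ ⟨subset_closure hxt, hcon⟩) (not_le.2 h4)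
  have hnhds := mem_interior_iff_mem_nhds.1 hint
  have hcont : ContinuousAt y.lyap (x t) := (T.continuousOn_interp y.V).continuousAt hnhds
  rw [mem_interior_iff_mem_nhds]
  filter_upwards [hnhds, hcont.eventually (gt_mem_nhds h4)] with z hz hzr
  exact ⟨hz, hy.lyap_nonneg hz, hzr.le⟩

end ControlSystem

end CPA

/-! ### The main theorem. -/

theorem theorem4 {n m p : ℕ} (S : CPA.ControlSystem n m p) (X : Set (CPA.State n))
    (T : CPA.Triangulation n)
    (hX : X ∈ CPA.regularSets (CPA.State n))
    (hU : S.inputs ∈ CPA.regularSets (Fin m → ℝ))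
    (hTX : T.carrier ⊆ X)
    (hf0 : S.f 0 = 0)
    (hf : ∀ k, T.PiecewiseC2 (fun x => S.f x k))
    (hG : ∀ k s, T.PiecewiseC2 (fun x => S.G x k s)) :
    -- the maxima that define the constants are attained
    ((0 < n → ∀ i, IsGreatest (S.muSet T i) (S.mu T i) ∧ IsGreatest (S.etaSet T i) (S.eta T i)) ∧
      ∀ s, IsGreatest ((fun u : Fin m → ℝ => |u s|) '' S.inputs) (S.inputBound s)) ∧
    -- the optimization is feasible
    (∃ y : CPA.Unknowns T m, S.Feasible y) ∧
    -- the gradients are linear in the vertex values, and the left side of the decrease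
    -- constraint is linear in `(V, L)` plus bilinear in `(U, Z)` and `(V, L)`
    (∀ i, ∃ Γ : (T.vertices → ℝ) →ₗ[ℝ] (Fin n → ℝ), ∀ W, T.grad i W = Γ W) ∧
    (∀ i j, ∃ (Φ : ((T.vertices → ℝ) × (Fin T.card → Fin n → ℝ)) →ₗ[ℝ] ℝ)
      (B : ((T.vertices → Fin m → ℝ) × (Fin T.card → ℝ)) →ₗ[ℝ]
        ((T.vertices → ℝ) × (Fin T.card → Fin n → ℝ)) →ₗ[ℝ] ℝ),
      ∀ y : CPA.Unknowns T m, S.phi y i j = Φ (y.V, y.l) ∧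
        S.dplus y i j = S.phi y i j + B (y.u, y.z) (y.V, y.l)) ∧
    -- every feasible point
    ∀ y : CPA.Unknowns T m, S.Feasible y →
      -- the inputs are admissible on the whole triangulation
      (∀ x ∈ T.carrier, y.ctrl x ∈ S.inputs) ∧
      -- `μ_i + η_i z_i` bounds the second derivatives of the closed loop and plays the role of `β_i`
      (∀ i, ∀ k q r : Fin n, ∀ ξ ∈ T.simplex i,
        |CPA.partialD2 (T.simplex i) (fun x => S.closedLoop y x k) q r ξ|
          ≤ S.mu T i + S.eta T i * y.z i) ∧
      (∀ i j, S.dplus y i j = (S.closedLoop y (T.vert i j)).ofLp ⬝ᵥ T.grad i y.V +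
        T.c i j * (S.mu T i + S.eta T i * y.z i) * ∑ k, y.l i k) ∧
      -- stability
      (0 < y.b₂ →
        (1 ≤ y.a → CPA.IsLyapunov (S.closedLoop y) T.carrier y.lyap y.a y.b₁ y.b₂) ∧
        (∃ b, CPA.IsLyapunov (S.closedLoop y) T.carrier y.lyap 1 b y.b₂) ∧
        CPA.IsLocallyExpStable (S.closedLoop y) T.carrier ∧
        ∀ r > 0, y.sublevel r ∈ CPA.regularSets (CPA.State n) →
          ∀ t₀ : ℝ, ∀ x₀ ∈ interior (y.sublevel r),
            -- the estimate holds for as long as a solution exists in the triangulation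
            (1 ≤ y.a → ∀ t₁ : ℝ, ∀ x : ℝ → CPA.State n, x t₀ = x₀ →
              CPA.IsSolution (S.closedLoop y) T.carrier (Icc t₀ t₁) x →
              ∀ t ∈ Icc t₀ t₁,
                ‖x t‖ ≤ (r / y.b₁) ^ (1 / y.a) * Real.exp (-(y.b₂ / y.a) * (t - t₀))) ∧
            -- if the sublevel set is not cut off by the boundary of the triangulation, a solution
            -- exists for all times, and all solutions stay in the interior of the sublevel set
            ((∀ v ∈ frontier T.carrier, r ≤ y.lyap v) →
              (∃ x : ℝ → CPA.State n, x t₀ = x₀ ∧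
                CPA.IsSolution (S.closedLoop y) (interior (y.sublevel r)) (Ici t₀) x) ∧
              ∀ t₁ : ℝ, ∀ x : ℝ → CPA.State n, x t₀ = x₀ →
                CPA.IsSolution (S.closedLoop y) T.carrier (Icc t₀ t₁) x →
                ∀ t ∈ Icc t₀ t₁, x t ∈ interior (y.sublevel r))) := by
  refine ⟨⟨fun hn i => ⟨CPA.ControlSystem.isGreatest_mu hn hf hG i,
    CPA.ControlSystem.isGreatest_eta hn hG i⟩, S.isGreatest_inputBound hU⟩,
    S.exists_feasible hU hf0, fun i => ⟨T.gradLinear i, T.grad_eq_gradLinear i⟩,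
    S.exists_linear_decomposition, fun y hy => ⟨fun x hx => hy.ctrl_mem hU hx,
    fun i k q r ξ hξ => hy.abs_partialD2_closedLoop_le hU hf hG i k q r hξ,
    CPA.ControlSystem.dplus_eq y, fun hb₂ => ⟨fun ha => ?_, ?_,
    hy.isLocallyExpStable hU hf0 hf hG hb₂, fun r hr hA t₀ x₀ hx₀ => ⟨?_, fun hfr => ⟨?_, ?_⟩⟩⟩⟩⟩
  · exact hy.isLyapunov hU hf hG hb₂ hy.a_pos hy.b₁_pos fun x hx => hy.rpow_le_lyap ha hx
  · obtain ⟨b, hb, hlow⟩ := hy.exists_mul_norm_le_lyap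
    exact ⟨b, hy.isLyapunov hU hf hG hb₂ one_pos hb fun x hx => by
      rw [Real.rpow_one]; exact hlow x hx⟩
  · rintro ha t₁ x rfl hx t ht
    exact hy.norm_le_of_mem_sublevel hU hf hG ha (interior_subset hx₀) hx ht
  -- Trapping with O the interior of the sublevel set and C the sublevel set itself, closed because
  -- it is compact.
  · refine CPA.ControlSystem.exists_solution_of_trapped hf hG y isOpen_interior hA.1.isClosed
      interior_subset (fun x hx => hx.1) hx₀ ?_
    rintro t₁ ht₁ x rfl hx -
    exact hy.mem_interior_sublevel hU hf hG hb₂ hr hfr hx₀ hx (right_mem_Icc.2 ht₁)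
  · rintro t₁ x rfl hx t ht
    exact hy.mem_interior_sublevel hU hf hG hb₂ hr hfr hx₀ hx ht
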